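/- A norm $\|\cdot\|_X$ on $\mathbb{R}^d$ is symmetric if it is invariant under permutations and sign changes of the coordinates. **(Orlicz-type approximation.)** Let $\beta\in(1,2)$, $d\ge 1$, let $\|\cdot\|_X$ be a symmetric norm on $\mathbb{R}^d$, and let $D,\alpha>1$. There is a non-decreasing $G:\mathbb{R}_+\to\mathbb{R}_+$ with $G(0)=0$ and $G(t)\to\infty$ as $t\to\infty$ such that for every $x\in\mathbb{R}^d$: if $\|x\|_X\le 1$ then $\sum_{i=1}^d G(|x_i|)\le 2\log_\beta d$; and if $\|x\|_X>\alpha D\cdot 7\log_\beta d$ then $\sum_{i=1}^d G(|x_i|/D)\ge \alpha\cdot 2\log_\beta d$. **(Data structure.)** There are an absolute constant $C>0$ and a single query program, and for every $\varepsilon\in(0,1/2)$ a constant $K_\varepsilon>0$, such that the following holds for all $d\ge 3$, $n\ge 1$, every symmetric norm $\|\cdot\|_X$ on $\mathbb{R}^d$, every dataset $p_1,\dots,p_n\in\mathbb{R}^d$ and every $r>0$. There is a data structure for the $c$-approximate near neighbor problem under $\|\cdot\|_X$ with $$c = C\,\frac{\log d\,\log\log d}{\varepsilon^2},\qquad \text{space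 at most } C\,d\,n^{1+\varepsilon},\qquad \text{query time at most } K_\varepsilon\,d\,n^{\varepsilon}.$$ That is, there is a random memory image, drawn before the query is known, on which the query program, run on any $q\in\mathbb{R}^d$, always halts within the stated time and leaves the memory as it found it; and for each fixed $q$ for which some $p_i$ satisfies $\|p_i-q\|_X\le r$, it outputs with probability at least $0.99$ an index $j$ with $\|p_j-q\|_X\le cr$. The model is a real RAM: word registers and memory cells hold integers of at most $C\log(nd)$ bits, real registers and memory cells hold real numbers; arithmetic, comparisons, reads, writes and jumps cost one step each; reals cannot be rounded to integers; the program, which is finite, does not depend on $\varepsilon,d,n$, the norm, the dataset or $r$. Space is the number of word cells plus the number of real cells. -/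

import Mathlib

open scoped NNReal

/-- A norm on `ℝ^d` invariant under permutations and sign changes of the coordinates. -/
structure IsSymmetricNorm {d : ℕ} (N : Seminorm ℝ (Fin d → ℝ)) : Prop where
  eq_zero : ∀ x, N x = 0 → x = 0
  perm : ∀ (σ : Equiv.Perm (Fin d)) (x : Fin d → ℝ), N (fun i => x (σ i)) = N x
  abs : ∀ x : Fin d → ℝ, N (fun i => |x i|) = N x

/-! The machine model: a real RAM with `w`-bit words. It has word registers and real registers
(a program only mentions finitely many), a memory of finitely many word cells and real cells, and
read-only access to the query vector. A program is a finite list of instructions; every executed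
instruction costs one step. Addresses are always words; there is no rounding of reals. -/

namespace RealRAM

inductive Op where
  | add
  | sub
  | mul
  | div

/-- Instructions. Register and jump arguments are fixed numbers; `p` always denotes a word register
whose content is used as an address. -/
inductive Instr where
  /-- word register `dst` gets the constant `k` (modulo `2 ^ w`) -/
  | const (dst k : ℕ)
  /-- word arithmetic modulo `2 ^ w` (`div` is the quotient) -/
  | wordOp (op : Op) (dst a b : ℕ)
  /-- exact real arithmetic -/
  | realOp (op : Op) (dst a b : ℕ)
  /-- real register `dst` gets the value of word register `a` -/
  | cast (dst a : ℕ)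
  | loadWord (dst p : ℕ)
  | loadReal (dst p : ℕ)
  | storeWord (p a : ℕ)
  | storeReal (p a : ℕ)
  /-- real register `dst` gets the coordinate of the query vector at address `p` -/
  | input (dst p : ℕ)
  /-- jump to instruction `l` if word register `a` is smaller than word register `b` -/
  | jumpWordLT (a b l : ℕ)
  /-- jump to instruction `l` if real register `a` is smaller than real register `b` -/
  | jumpRealLT (a b l : ℕ)
  | jump (l : ℕ)

abbrev Program := List Instr

/-- A memory with `S` word cells and `S` real cells. -/
structure Memory (w S : ℕ) where
  word : Fin S → BitVec w
  real : Fin S → ℝ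

structure Config (w S : ℕ) where
  pc : ℕ
  wreg : ℕ → BitVec w
  rreg : ℕ → ℝ
  mem : Memory w S

/-- The content of cell `a` of an array; cells outside the array read as zero. -/
def fetch {α : Type} [Zero α] {S : ℕ} (m : Fin S → α) (a : ℕ) : α :=
  if h : a < S then m ⟨a, h⟩ else 0

/-- Write `v` to cell `a` of an array; writing outside the array has no effect. -/
def write {α : Type} {S : ℕ} (m : Fin S → α) (a : ℕ) (v : α) : Fin S → α :=
  fun i => if (i : ℕ) = a then v else m i

def Op.onWord {w : ℕ} : Op → BitVec w → BitVec w → BitVec w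
  | .add, x, y => x + y
  | .sub, x, y => x - y
  | .mul, x, y => x * y
  | .div, x, y => x / y

noncomputable def Op.onReal : Op → ℝ → ℝ → ℝ
  | .add, x, y => x + y
  | .sub, x, y => x - y
  | .mul, x, y => x * y
  | .div, x, y => x / y

variable {w S d : ℕ}

/-- The effect of one instruction on query vector `q`. -/
noncomputable def exec (q : Fin d → ℝ) (c : Config w S) : Instr → Config w S
  | .const dst k =>
      { c with pc := c.pc + 1, wreg := Function.update c.wreg dst (BitVec.ofNat w k) }
  | .wordOp op dst a b =>
      { c with pc := c.pc + 1,
               wreg := Function.update c.wreg dst (op.onWord (c.wreg a) (c.wreg b)) }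
  | .realOp op dst a b =>
      { c with pc := c.pc + 1,
               rreg := Function.update c.rreg dst (op.onReal (c.rreg a) (c.rreg b)) }
  | .cast dst a =>
      { c with pc := c.pc + 1, rreg := Function.update c.rreg dst ((c.wreg a).toNat : ℝ) }
  | .loadWord dst p =>
      { c with pc := c.pc + 1,
               wreg := Function.update c.wreg dst (fetch c.mem.word (c.wreg p).toNat) }
  | .loadReal dst p =>
      { c with pc := c.pc + 1,
               rreg := Function.update c.rreg dst (fetch c.mem.real (c.wreg p).toNat) }
  | .storeWord p a =>
      { c with pc := c.pc + 1,
               mem := { c.mem with word := write c.mem.word (c.wreg p).toNat (c.wreg a) } }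
  | .storeReal p a =>
      { c with pc := c.pc + 1,
               mem := { c.mem with real := write c.mem.real (c.wreg p).toNat (c.rreg a) } }
  | .input dst p =>
      { c with pc := c.pc + 1,
               rreg := Function.update c.rreg dst (fetch q (c.wreg p).toNat) }
  | .jumpWordLT a b l =>
      { c with pc := if (c.wreg a).toNat < (c.wreg b).toNat then l else c.pc + 1 }
  | .jumpRealLT a b l =>
      { c with pc := if c.rreg a < c.rreg b then l else c.pc + 1 }
  | .jump l => { c with pc := l }

/-- One step; the machine has halted once the program counter is outside the program. -/
noncomputable def step (prog : Program) (q : Fin d → ℝ) (c : Config w S) : Config w S :=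
  match prog[c.pc]? with
  | some i => exec q c i
  | none => c

/-- The initial configuration: all registers are zero. -/
def start (m : Memory w S) : Config w S :=
  { pc := 0, wreg := fun _ => 0, rreg := fun _ => 0, mem := m }

/-- The configuration after `T` steps on memory `m` and query vector `q`. -/
noncomputable def run (prog : Program) (m : Memory w S) (q : Fin d → ℝ) (T : ℕ) : Config w S :=
  (step prog q)^[T] (start m)

/-- The output is word register `0`. -/
def Config.output (c : Config w S) : ℕ := (c.wreg 0).toNat

end RealRAM

/-- `prog` answers `c`-approximate near neighbor queries with radius `r` on the dataset `P`, for
the distance `N (x - y)`, from a randomly preprocessed memory of `S` word cells (of `w` bits each)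
and `S` real cells, in at most `T` steps. The random memory is chosen before the query. Every query
halts within `T` steps and leaves the memory as it was. For every query `q` such that some data
point is within distance `r`, the output is, except with probability at most `1/100`, (the index
of) a data point within distance `c * r` of `q`. -/
def SolvesANN (prog : RealRAM.Program) {d n : ℕ} (N : Seminorm ℝ (Fin d → ℝ))
    (P : Fin n → Fin d → ℝ) (r c : ℝ) (w S T : ℕ) : Prop :=
  ∃ (Ω : Type) (_ : MeasurableSpace Ω) (μ : MeasureTheory.Measure Ω)
    (mem : Ω → RealRAM.Memory w S),
    MeasureTheory.IsProbabilityMeasure μ ∧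
    (∀ (ω : Ω) (q : Fin d → ℝ),
      prog.length ≤ (RealRAM.run prog (mem ω) q T).pc ∧
      (RealRAM.run prog (mem ω) q T).mem = mem ω) ∧
    ∀ q : Fin d → ℝ, (∃ i, N (P i - q) ≤ r) →
      μ {ω | ¬ ∃ i : Fin n, (RealRAM.run prog (mem ω) q T).output = i ∧ N (P i - q) ≤ c * r}
        ≤ 1 / 100

/-!
# Near neighbor search under symmetric norms

**Orlicz functions.** For a symmetric norm `N` let `fund N k` be the norm of a vector with `k` ones.
If `N x ≤ 1`, fewer than `k` coordinates of `x` exceed `1 / fund N k`. Hence the function that jumps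
by `2⁻ʲ` at `1 / fund N (2 ^ j)`, and to a huge value beyond `1 / fund N 1`, has a small sum over
the coordinates of `x`. Conversely, cutting a vector at the dyadic levels `1 / fund N (2 ^ j)` and
applying the triangle inequality bounds its norm by this sum
(`IsSymmetricNorm.norm_le_sum_dyadic`, `IsSymmetricNorm.exists_orlicz`).

**Reduction to the maximum norm.** Draw independent widths `t i > 0` with
`P (s ≤ t i) ≈ exp (-lam * G s)`. Then `|x i| ≤ t i` holds for all `i` with probability about
`exp (-lam * ∑ i, G |x i|)` (`exists_random_widths`). With a suitable rate `lam` and about `n ^ κ`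
independent copies, a given near point is, with high probability, within the widths of the query in
some copy, while no far point is within `D` times the widths in any copy (`measure_pi_fail_le`).

**The maximum norm.** Each copy is searched with a decision tree of approximation
`D = O(log log d / κ)` (`exists_searchTree`). If some coordinate has a tail that drops slowly from
one step of the width to the next, a threshold between the two steps splits the point set into two
overlapping parts, with the sum of the sizes to the power `1 + κ` not increasing. Otherwise all
tails shrink doubly exponentially, and after `O(log log d / κ)` steps half of the points are left in
a small box: a single one of them answers for the box, or else the whole box can be discarded.

**The machine.** The trees are laid out in memory such that an unsuccessful search in one tree
continues at the root of the next. The query program `RealRAM.annProg` follows the pointers and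
never writes to memory (`RealRAM.exists_memory`).
-/

/-! ### Symmetric norms and Orlicz functions -/

/-- The indicator vector of a set of coordinates. -/
noncomputable def indVec {d : ℕ} (A : Finset (Fin d)) : Fin d → ℝ := fun i => if i ∈ A then 1 else 0

lemma indVec_eq_add {d : ℕ} {A B : Finset (Fin d)} (h : B ⊆ A) :
    indVec A = indVec B + indVec (A \ B) := by
  funext i
  simp only [indVec, Pi.add_apply, Finset.mem_sdiff]
  by_cases hi : i ∈ B
  · simp [hi, h hi]
  · simp [hi]

/-- The fundamental function of a symmetric norm: the norm of a vector with `k` ones (with `d` ones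
if `d < k`). -/
noncomputable def fund {d : ℕ} (N : Seminorm ℝ (Fin d → ℝ)) (k : ℕ) : ℝ :=
  N (indVec (Finset.univ.filter fun i : Fin d => (i : ℕ) < k))

namespace IsSymmetricNorm

variable {d : ℕ} {N : Seminorm ℝ (Fin d → ℝ)}

/-- `update x i a` is a convex combination of `x` and its reflection in coordinate `i`. -/
lemma update_le (hN : IsSymmetricNorm N) (x : Fin d → ℝ) (i : Fin d) {a : ℝ}
    (ha : |a| ≤ |x i|) : N (Function.update x i a) ≤ N x := by
  by_cases hx : x i = 0
  · have : a = x i := by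
      rw [hx] at ha ⊢
      simpa using ha
    rw [this, Function.update_eq_self]
  have hr : N (Function.update x i (-x i)) = N x := by
    rw [← hN.abs, ← hN.abs x]
    congr 1
    funext k
    by_cases hk : k = i
    · subst hk; simp
    · simp [hk]
  have hab : |a / x i| ≤ 1 := by
    rw [abs_div]
    exact div_le_one_of_le₀ ha (abs_nonneg _)
  obtain ⟨h1, h2⟩ := abs_le.1 hab
  have key : Function.update x i a =
      ((1 + a / x i) / 2) • x + ((1 - a / x i) / 2) • Function.update x i (-x i) := by
    funext k
    by_cases hk : k = i
    · subst hk
      simp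
      field_simp
      ring
    · simp [hk]
      ring
  rw [key]
  refine (map_add_le_add _ _ _).trans ?_
  rw [map_smul_eq_mul, map_smul_eq_mul, hr, Real.norm_of_nonneg (by linarith),
    Real.norm_of_nonneg (by linarith)]
  exact le_of_eq (by ring)

lemma mono (hN : IsSymmetricNorm N) {x y : Fin d → ℝ} (h : ∀ i, |x i| ≤ |y i|) : N x ≤ N y := by
  have key : ∀ s : Finset (Fin d), N (fun i => if i ∈ s then x i else y i) ≤ N y := by
    intro s
    induction s using Finset.induction_on with
    | empty => simp
    | insert a s has ih =>
      refine le_trans ?_ ih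
      have : (fun i => if i ∈ insert a s then x i else y i) =
          Function.update (fun i => if i ∈ s then x i else y i) a (x a) := by
        funext k
        by_cases hk : k = a
        · subst hk; simp
        · simp [hk]
      rw [this]
      exact hN.update_le _ _ (by simpa [has] using h a)
  simpa using key Finset.univ

lemma indVec_mono (hN : IsSymmetricNorm N) {A B : Finset (Fin d)} (h : A ⊆ B) :
    N (indVec A) ≤ N (indVec B) := by
  refine hN.mono fun i => ?_
  unfold indVec
  by_cases hA : i ∈ A
  · simp [hA, h hA]
  · simp [hA]

lemma indVec_eq_of_card (hN : IsSymmetricNorm N) {A B : Finset (Fin d)} (h : A.card = B.card) :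
    N (indVec A) = N (indVec B) := by
  let e : {x // x ∈ A} ≃ {x // x ∈ B} := Finset.equivOfCardEq h
  rw [← hN.perm e.extendSubtype (indVec B)]
  congr 1
  funext i
  unfold indVec
  by_cases hA : i ∈ A
  · have := e.extendSubtype_mem i hA
    simp [hA, this]
  · have := e.extendSubtype_not_mem i hA
    simp [hA, this]

lemma card_initial {k : ℕ} (hk : k ≤ d) :
    (Finset.univ.filter fun i : Fin d => (i : ℕ) < k).card = k := by
  simp [Fin.card_filter_val_lt, hk]

lemma indVec_eq_fund (hN : IsSymmetricNorm N) (A : Finset (Fin d)) :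
    N (indVec A) = fund N A.card := by
  refine hN.indVec_eq_of_card ?_
  rw [card_initial]
  simpa using Finset.card_le_univ A

lemma fund_mono (hN : IsSymmetricNorm N) : Monotone (fund N) := by
  intro a b hab
  refine hN.indVec_mono fun i hi => ?_
  simp only [Finset.mem_filter, Finset.mem_univ, true_and] at hi ⊢
  omega

lemma fund_pos (hN : IsSymmetricNorm N) {k : ℕ} (hk : 0 < k) (hkd : k ≤ d) : 0 < fund N k := by
  refine lt_of_le_of_ne (apply_nonneg _ _) fun h => ?_
  have := congrFun (hN.eq_zero _ h.symm) ⟨0, by omega⟩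
  simp [indVec, hk] at this

/-- The fundamental function grows at most linearly. -/
lemma indVec_le (hN : IsSymmetricNorm N) {k : ℕ} (hk : 0 < k) (hkd : k ≤ d)
    (A : Finset (Fin d)) : N (indVec A) ≤ ((A.card : ℝ) / k + 1) * fund N k := by
  have hf := hN.fund_pos hk hkd
  induction hc : A.card using Nat.strong_induction_on generalizing A with
  | _ a ih =>
    rcases le_or_gt a k with hak | hak
    · rw [hN.indVec_eq_fund, hc]
      refine (hN.fund_mono hak).trans (le_mul_of_one_le_left hf.le ?_)
      have : (0 : ℝ) ≤ (a : ℝ) / k := by positivity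
      linarith
    · obtain ⟨B, hBA, hB⟩ := Finset.exists_subset_card_eq (s := A) (n := k) (by omega)
      have hcard : (A \ B).card = a - k := by
        rw [Finset.card_sdiff_of_subset hBA, hc, hB]
      have h := ih (a - k) (by omega) (A \ B) hcard
      rw [indVec_eq_add hBA]
      refine (map_add_le_add _ _ _).trans ?_
      rw [hN.indVec_eq_fund B, hB]
      have hk' : (k : ℝ) ≠ 0 := by positivity
      have e : (((a - k : ℕ) : ℝ) / k + 1) = (a : ℝ) / k := by
        rw [Nat.cast_sub hak.le]
        field_simp
        ring
      rw [e] at h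
      linarith

/-- A vector of norm at most one has fewer than `k` coordinates above `1 / fund N k`. -/
lemma card_large_lt (hN : IsSymmetricNorm N) {k : ℕ} (hk : 0 < k) (hkd : k ≤ d)
    {x : Fin d → ℝ} (hx : N x ≤ 1) :
    (Finset.univ.filter fun i => (fund N k)⁻¹ < |x i|).card < k := by
  by_contra! hle
  obtain ⟨B, hB, hBk⟩ := Finset.exists_subset_card_eq hle
  have hf := hN.fund_pos hk hkd
  have hne : B.Nonempty := Finset.card_pos.1 (by omega)
  obtain ⟨i₀, hi₀, hmin⟩ := B.exists_min_image (fun i => |x i|) hne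
  have hlt : (fund N k)⁻¹ < |x i₀| := (Finset.mem_filter.1 (hB hi₀)).2
  have h1 : N (|x i₀| • indVec B) ≤ N x := by
    refine hN.mono fun i => ?_
    by_cases hi : i ∈ B
    · simpa [indVec, hi] using hmin i hi
    · simp [indVec, hi]
  rw [map_smul_eq_mul, hN.indVec_eq_fund, hBk, Real.norm_eq_abs, abs_abs] at h1
  have h2 : 1 < |x i₀| * fund N k := by
    rw [inv_lt_iff_one_lt_mul₀ hf] at hlt
    linarith
  linarith

/-- A vector with entries at most `s`, supported on `A`, is dominated by `s • indVec A`. -/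
lemma le_mul_indVec (hN : IsSymmetricNorm N) {x : Fin d → ℝ} {A : Finset (Fin d)} {s : ℝ}
    (hs : 0 ≤ s) (h : ∀ i ∈ A, |x i| ≤ s) :
    N (fun i => if i ∈ A then x i else 0) ≤ s * N (indVec A) := by
  have : N (fun i => if i ∈ A then x i else 0) ≤ N (s • indVec A) := by
    refine hN.mono fun i => ?_
    by_cases hi : i ∈ A
    · simpa [indVec, hi, abs_of_nonneg hs] using h i hi
    · simp [indVec, hi]
  rwa [map_smul_eq_mul, Real.norm_of_nonneg hs] at this

/-- The dyadic part of the Orlicz function attached to a symmetric norm. -/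
noncomputable def dyadic (N : Seminorm ℝ (Fin d → ℝ)) (s : ℝ) : ℝ :=
  ∑ j ∈ Finset.range (Nat.log 2 d + 1), if (fund N (2 ^ j))⁻¹ < s then ((2 : ℝ) ^ j)⁻¹ else 0

lemma dyadic_nonneg (s : ℝ) : 0 ≤ dyadic N s :=
  Finset.sum_nonneg fun j _ => by split_ifs <;> positivity

lemma dyadic_mono : Monotone (dyadic N) := by
  intro a b hab
  refine Finset.sum_le_sum fun j _ => ?_
  split_ifs with h1 h2 h2
  · exact le_rfl
  · exact absurd (h1.trans_le hab) h2
  · positivity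
  · exact le_rfl

lemma pow_le_dim (hd : 1 ≤ d) {j : ℕ} (hj : j ≤ Nat.log 2 d) : 2 ^ j ≤ d :=
  (Nat.pow_le_pow_right (by norm_num) hj).trans (Nat.pow_log_le_self 2 (by omega))

lemma le_inv_fund (hN : IsSymmetricNorm N) (hd : 1 ≤ d) {j : ℕ} (hj : j ≤ Nat.log 2 d) :
    (fund N d)⁻¹ ≤ (fund N (2 ^ j))⁻¹ :=
  inv_anti₀ (hN.fund_pos (by positivity) (pow_le_dim hd hj)) (hN.fund_mono (pow_le_dim hd hj))

lemma dyadic_eq_zero (hN : IsSymmetricNorm N) (hd : 1 ≤ d) {s : ℝ} (hs : s ≤ (fund N d)⁻¹) :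
    dyadic N s = 0 := by
  refine Finset.sum_eq_zero fun j hj => if_neg (not_lt.2 (hs.trans ?_))
  exact hN.le_inv_fund hd (by simpa [Nat.lt_succ_iff] using hj)

lemma sum_dyadic_le (hN : IsSymmetricNorm N) (hd : 1 ≤ d) {x : Fin d → ℝ} (hx : N x ≤ 1) :
    ∑ i, dyadic N |x i| ≤ Nat.log 2 d := by
  unfold dyadic
  rw [Finset.sum_comm]
  have h : ∀ j ∈ Finset.range (Nat.log 2 d + 1),
      (∑ i, if (fund N (2 ^ j))⁻¹ < |x i| then ((2 : ℝ) ^ j)⁻¹ else 0) ≤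
        if j = 0 then 0 else 1 := by
    intro j hj
    have hj' : j ≤ Nat.log 2 d := by simpa [Nat.lt_succ_iff] using hj
    have hlt := hN.card_large_lt (k := 2 ^ j) (by positivity) (pow_le_dim hd hj') hx
    rw [← Finset.sum_filter, Finset.sum_const, nsmul_eq_mul]
    split_ifs with h0
    · subst h0
      simp only [pow_zero, Nat.lt_one_iff, Finset.card_eq_zero] at hlt
      simp [hlt]
    · rw [← div_eq_mul_inv]
      refine div_le_one_of_le₀ ?_ (by positivity)
      exact_mod_cast hlt.le
  refine (Finset.sum_le_sum h).trans ?_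
  rw [Finset.sum_range_succ']
  simp

/-- If no coordinate exceeds `1 / fund N 1`, the dyadic function controls the norm: cut the vector
into the dyadic levels of its coordinates and use the triangle inequality. -/
lemma norm_le_sum_dyadic (hN : IsSymmetricNorm N) (hd : 1 ≤ d) {y : Fin d → ℝ}
    (hy : ∀ i, |y i| ≤ (fund N 1)⁻¹) :
    N y ≤ 2 * ∑ i, dyadic N |y i| + Nat.log 2 d + 2 := by
  classical
  set J := Nat.log 2 d with hJ
  -- `lev m` holds the coordinates of level at least `m`
  set lev : ℕ → Finset (Fin d) :=
    fun m => Finset.univ.filter fun i => |y i| ≤ (fund N (2 ^ m))⁻¹ with hlev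
  have hfp : ∀ j ≤ J, 0 < fund N (2 ^ j) := fun j hj =>
    hN.fund_pos (by positivity) (pow_le_dim hd hj)
  have hlast : N (fun i => if i ∈ lev J then y i else 0) ≤ 2 := by
    refine (hN.le_mul_indVec (s := (fund N (2 ^ J))⁻¹) (inv_nonneg.2 (hfp J le_rfl).le)
      fun i hi => (Finset.mem_filter.1 hi).2).trans ?_
    have h2 : N (indVec (lev J)) ≤ 2 * fund N (2 ^ J) := by
      have h6 : d < 2 ^ J * 2 := by
        have := Nat.lt_pow_succ_log_self (b := 2) (by norm_num) d
        rwa [pow_succ] at this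
      -- split off `2 ^ J` coordinates, fewer than `2 ^ J` remain
      rcases le_or_gt (lev J).card (2 ^ J) with hc | hc
      · rw [hN.indVec_eq_fund]
        have := hN.fund_mono hc
        have := hfp J le_rfl
        linarith
      · obtain ⟨B, hBA, hB⟩ := Finset.exists_subset_card_eq hc.le
        have hcard : (lev J \ B).card ≤ 2 ^ J := by
          rw [Finset.card_sdiff_of_subset hBA, hB]
          have : (lev J).card ≤ d := by simpa using Finset.card_le_univ (lev J)
          omega
        rw [indVec_eq_add hBA]
        refine (map_add_le_add _ _ _).trans ?_
        rw [hN.indVec_eq_fund, hN.indVec_eq_fund, hB]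
        have := hN.fund_mono hcard
        linarith
    calc (fund N (2 ^ J))⁻¹ * N (indVec (lev J)) ≤ (fund N (2 ^ J))⁻¹ * (2 * fund N (2 ^ J)) :=
          mul_le_mul_of_nonneg_left h2 (inv_nonneg.2 (hfp J le_rfl).le)
      _ = 2 := by have := (hfp J le_rfl).ne'; field_simp
  have hstep : ∀ j < J, N (fun i => if i ∈ lev j \ lev (j + 1) then y i else 0) ≤
      ((lev j \ lev (j + 1)).card : ℝ) / 2 ^ j + 1 := by
    intro j hj
    have hp := hfp j hj.le
    refine (hN.le_mul_indVec (s := (fund N (2 ^ j))⁻¹) (inv_nonneg.2 hp.le)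
      fun i hi => (Finset.mem_filter.1 (Finset.mem_sdiff.1 hi).1).2).trans ?_
    have h1 := hN.indVec_le (k := 2 ^ j) (by positivity) (pow_le_dim hd hj.le)
      (lev j \ lev (j + 1))
    push_cast at h1
    calc _ ≤ (fund N (2 ^ j))⁻¹ * ((((lev j \ lev (j + 1)).card : ℝ) / 2 ^ j + 1) *
          fund N (2 ^ j)) := mul_le_mul_of_nonneg_left h1 (inv_nonneg.2 hp.le)
      _ = _ := by field_simp
  have hanti : ∀ j < J, lev (j + 1) ⊆ lev j := by
    intro j hj i hi
    simp only [hlev, Finset.mem_filter, Finset.mem_univ, true_and] at hi ⊢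
    refine hi.trans (inv_anti₀ (hfp j hj.le) (hN.fund_mono ?_))
    exact Nat.pow_le_pow_right (by norm_num) (by omega)
  -- peel off the levels one by one
  have htel : ∀ m ≤ J, N y ≤ (∑ j ∈ Finset.range m,
      (((lev j \ lev (j + 1)).card : ℝ) / 2 ^ j + 1)) +
        N (fun i => if i ∈ lev m then y i else 0) := by
    intro m
    induction m with
    | zero =>
      intro _
      have : ∀ i, i ∈ lev 0 := fun i => by simp [hlev]; exact hy i
      simp [this]
    | succ m ih =>
      intro hm
      refine (ih (by omega)).trans ?_
      rw [Finset.sum_range_succ, add_assoc]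
      gcongr
      have hsplit : (fun i => if i ∈ lev m then y i else 0) =
          (fun i => if i ∈ lev m \ lev (m + 1) then y i else 0) +
            fun i => if i ∈ lev (m + 1) then y i else 0 := by
        funext i
        have := @hanti m (by omega) i
        simp only [Pi.add_apply, Finset.mem_sdiff]
        by_cases h1 : i ∈ lev (m + 1)
        · simp [h1, this h1]
        · simp [h1]
      rw [hsplit]
      exact (map_add_le_add _ _ _).trans (by gcongr; exact hstep m (by omega))
  have hmain := htel J le_rfl
  have hcount : ∑ j ∈ Finset.range J, ((lev j \ lev (j + 1)).card : ℝ) / 2 ^ j ≤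
      2 * ∑ i, dyadic N |y i| := by
    unfold dyadic
    rw [Finset.sum_comm, Finset.mul_sum, ← hJ, Finset.sum_range_succ']
    refine le_trans ?_ (le_add_of_nonneg_right
      (mul_nonneg (by norm_num) (Finset.sum_nonneg fun i _ => by split_ifs <;> positivity)))
    refine Finset.sum_le_sum fun j _ => ?_
    rw [← Finset.sum_filter, Finset.sum_const, nsmul_eq_mul, pow_succ]
    have : (lev j \ lev (j + 1)).card ≤
        (Finset.univ.filter fun i => (fund N (2 ^ (j + 1)))⁻¹ < |y i|).card := by
      refine Finset.card_le_card fun i hi => ?_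
      simpa [hlev] using (Finset.mem_sdiff.1 hi).2
    have h' : ((lev j \ lev (j + 1)).card : ℝ) ≤
        ((Finset.univ.filter fun i => (fund N (2 ^ (j + 1)))⁻¹ < |y i|).card : ℝ) := by
      exact_mod_cast this
    rw [pow_succ] at h'
    rw [div_le_iff₀ (by positivity)]
    refine h'.trans (le_of_eq ?_)
    field_simp
    ring
  rw [Finset.sum_add_distrib] at hmain
  simp only [Finset.sum_const, Finset.card_range, nsmul_eq_mul, mul_one] at hmain
  linarith

end IsSymmetricNorm

/-- The Orlicz-type approximation of a symmetric norm, by a function vanishing near zero. -/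
theorem IsSymmetricNorm.exists_orlicz {β : ℝ} (hβ1 : 1 < β) (hβ2 : β < 2) {d : ℕ} (hd : 1 ≤ d)
    {N : Seminorm ℝ (Fin d → ℝ)} (hN : IsSymmetricNorm N) {α : ℝ} (hα : 1 < α) :
    ∃ G : ℝ≥0 → ℝ≥0, Monotone G ∧ Filter.Tendsto G Filter.atTop Filter.atTop ∧
      (∃ δ : ℝ≥0, 0 < δ ∧ G δ = 0) ∧
      ∀ x : Fin d → ℝ,
        (N x ≤ 1 → (∑ i, (G ‖x i‖₊ : ℝ)) ≤ 2 * Real.logb β d) ∧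
        (α * (7 * Real.logb β d) < N x → α * (2 * Real.logb β d) ≤ ∑ i, (G ‖x i‖₊ : ℝ)) := by
  set L := Real.logb β d with hL
  have hd1 : (1 : ℝ) ≤ d := by exact_mod_cast hd
  have hL0 : 0 ≤ L := Real.logb_nonneg hβ1 hd1
  have hlogb : Real.logb 2 d ≤ L := by
    rw [hL, Real.logb, Real.logb]
    exact div_le_div_of_nonneg_left (Real.log_nonneg hd1) (Real.log_pos hβ1)
      (Real.log_le_log (by linarith) hβ2.le)
  have hJL : (Nat.log 2 d : ℝ) ≤ L := le_trans (by exact_mod_cast Real.natLog_le_logb d 2) hlogb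
  set H := α * (2 * L) with hH
  have hH0 : 0 ≤ H := by positivity
  -- beyond `1 / fund N 1`, where no vector of the unit ball has a coordinate, `G` may be huge
  set g : ℝ → ℝ := fun s => IsSymmetricNorm.dyadic N s + if (fund N 1)⁻¹ < s then H + s else 0
    with hg
  have hf1 : 0 < fund N 1 := hN.fund_pos one_pos hd
  have hgpos : ∀ s, 0 ≤ g s := fun s => by
    have h0 := IsSymmetricNorm.dyadic_nonneg (N := N) s
    simp only [hg]
    split_ifs with h
    · have := (inv_pos.2 hf1).trans h
      linarith
    · linarith
  have hgmono : Monotone g := by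
    intro a b hab
    have h0 := IsSymmetricNorm.dyadic_mono (N := N) hab
    simp only [hg]
    split_ifs with h1 h2 h2
    · linarith
    · exact absurd (h1.trans_le hab) h2
    · have := (inv_pos.2 hf1).trans h2
      linarith
    · linarith
  refine ⟨fun s => (⟨g s, hgpos s⟩ : ℝ≥0), fun a b hab => hgmono (by exact_mod_cast hab), ?_, ?_, ?_⟩
  · refine Filter.tendsto_atTop_mono' _ ?_ Filter.tendsto_id
    filter_upwards [Filter.eventually_gt_atTop (⟨(fund N 1)⁻¹, (inv_pos.2 hf1).le⟩ : ℝ≥0)] with s hs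
    have hs' : (fund N 1)⁻¹ < s := by exact_mod_cast hs
    refine NNReal.coe_le_coe.1 ?_
    change (s : ℝ) ≤ g s
    simp only [hg, if_pos hs']
    have := IsSymmetricNorm.dyadic_nonneg (N := N) (s : ℝ)
    linarith
  · have hfd := hN.fund_pos (by omega) (le_refl d)
    refine ⟨⟨(fund N d)⁻¹, (inv_pos.2 hfd).le⟩, by exact_mod_cast inv_pos.2 hfd, ?_⟩
    ext
    change g (fund N d)⁻¹ = 0
    have h1 : (fund N d)⁻¹ ≤ (fund N 1)⁻¹ := by simpa using hN.le_inv_fund hd (Nat.zero_le _)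
    simp only [hg, hN.dyadic_eq_zero hd le_rfl, if_neg (not_lt.2 h1), add_zero]
  · intro x
    change (N x ≤ 1 → ∑ i, g |x i| ≤ 2 * L) ∧ (α * (7 * L) < N x → H ≤ ∑ i, g |x i|)
    constructor
    · intro hx
      have hsm : ∀ i, ¬ (fund N 1)⁻¹ < |x i| := by
        have := hN.card_large_lt one_pos hd hx
        rw [Nat.lt_one_iff, Finset.card_eq_zero, Finset.filter_eq_empty_iff] at this
        exact fun i => this (Finset.mem_univ i)
      simp only [hg, hsm, if_false, add_zero]
      have := hN.sum_dyadic_le hd hx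
      linarith
    · intro hx
      by_cases hbig : ∃ i, (fund N 1)⁻¹ < |x i|
      · obtain ⟨i, hi⟩ := hbig
        refine le_trans ?_ (Finset.single_le_sum (f := fun i => g |x i|) (fun i _ => hgpos _)
          (Finset.mem_univ i))
        simp only [hg, if_pos hi]
        have := IsSymmetricNorm.dyadic_nonneg (N := N) |x i|
        have := abs_nonneg (x i)
        linarith
      · push Not at hbig
        rcases Nat.lt_or_ge d 2 with h2 | h2
        · have : d = 1 := by omega
          have : H = 0 := by simp [hH, hL, this]
          rw [this]
          exact Finset.sum_nonneg fun i _ => hgpos _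
        · have hL1 : 1 ≤ L := by
            refine le_trans ?_ hlogb
            rw [Real.le_logb_iff_rpow_le (by norm_num) (by linarith)]
            simpa using (show (2 : ℝ) ≤ d by exact_mod_cast h2)
          have hle := hN.norm_le_sum_dyadic hd hbig
          simp only [hg, not_lt.2 (hbig _), if_false, add_zero]
          nlinarith

/-! ### Search trees for the maximum norm -/

/-- A decision tree on data points indexed by `Fin n` in dimension `d`. A `split` node compares one
coordinate of the query with a threshold; a `ball` node tests one data point and, if the point is
too far from the query, passes on to its child. -/
inductive SearchTree (n d : ℕ) where
  | nil
  | split (i : Fin d) (s : ℝ) (l r : SearchTree n d)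
  | ball (j : Fin n) (child : SearchTree n d)

namespace SearchTree

variable {n d : ℕ}

/-- The number of nodes. -/
def size : SearchTree n d → ℕ
  | nil => 0
  | split _ _ l r => 1 + l.size + r.size
  | ball _ t => 1 + t.size

/-- An upper bound on the number of machine steps that a search takes. -/
def cost : SearchTree n d → ℕ
  | nil => 0
  | split _ _ l r => 16 + max l.cost r.cost
  | ball _ t => 12 * d + 24 + t.cost

open Classical in
/-- The data point found by a search, for query `q`; a point `p` is accepted by a `ball` node if
`|p i - q i| ≤ τ i` for all coordinates `i`. -/
noncomputable def search (P : Fin n → Fin d → ℝ) (τ q : Fin d → ℝ) :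
    SearchTree n d → Option (Fin n)
  | nil => none
  | split i s l r => if q i < s then l.search P τ q else r.search P τ q
  | ball j t => if ∀ i, |P j i - q i| ≤ τ i then some j else t.search P τ q

lemma search_sound {P : Fin n → Fin d → ℝ} {τ q : Fin d → ℝ} {T : SearchTree n d} {j : Fin n}
    (h : T.search P τ q = some j) : ∀ i, |P j i - q i| ≤ τ i := by
  induction T with
  | nil => simp [search] at h
  | split i s l r ihl ihr =>
    rw [search] at h
    split_ifs at h with hq
    · exact ihl h
    · exact ihr h
  | ball k t ih =>
    rw [search] at h
    split_ifs at h with hk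
    · rw [← Option.some.inj h]
      exact hk
    · exact ih h

end SearchTree

lemma exists_median {ι : Type*} (f : ι → ℝ) {A : Finset ι} (hA : A.Nonempty) :
    ∃ m : ℝ, 2 * (A.filter fun j => m < f j).card ≤ A.card ∧
      2 * (A.filter fun j => f j < m).card ≤ A.card := by
  classical
  -- the least value that at most half of the points exceed
  have hne : (A.filter fun k => 2 * (A.filter fun j => f k < f j).card ≤ A.card).Nonempty := by
    obtain ⟨k, hk, hmax⟩ := A.exists_max_image f hA
    refine ⟨k, Finset.mem_filter.2 ⟨hk, ?_⟩⟩
    rw [Finset.filter_false_of_mem fun j hj => not_lt.2 (hmax j hj)]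
    simp
  obtain ⟨k, hk, hmin⟩ := Finset.exists_min_image _ f hne
  rw [Finset.mem_filter] at hk
  refine ⟨f k, hk.2, ?_⟩
  by_cases hE : (A.filter fun j => f j < f k).Nonempty
  · obtain ⟨l, hl, hlmax⟩ := Finset.exists_max_image _ f hE
    rw [Finset.mem_filter] at hl
    have h1 : A.card < 2 * (A.filter fun j => f l < f j).card := by
      by_contra! hle
      exact absurd (hmin l (Finset.mem_filter.2 ⟨hl.1, hle⟩)) (not_le.2 hl.2)
    have h2 : (A.filter fun j => f j < f k).card + (A.filter fun j => f l < f j).card ≤ A.card := by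
      rw [← Finset.card_union_of_disjoint]
      · exact Finset.card_le_card (Finset.union_subset (Finset.filter_subset _ _)
          (Finset.filter_subset _ _))
      · refine Finset.disjoint_left.2 fun j hj hj' => ?_
        exact absurd (hlmax j hj) (not_le.2 (Finset.mem_filter.1 hj').2)
    omega
  · rw [Finset.not_nonempty_iff_eq_empty.1 hE]
    simp

/-- A sequence in `[0, 1/2]` that, while it stays above `δ`, drops below the power `1 + κ` of its
previous value, falls doubly exponentially fast. -/
lemma exists_slow_drop_or_lt {u : ℕ → ℝ} {κ δ : ℝ} {J : ℕ} (hκ : 0 < κ) (hu0 : ∀ j, 0 ≤ u j)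
    (hanti : Antitone u) (hhalf : u 0 ≤ 1 / 2)
    (hJ : (1 / 2 : ℝ) ^ ((1 + κ) ^ J) < δ) :
    (∃ j, δ ≤ u (j + 1) ∧ u j ^ (1 + κ) ≤ u (j + 1)) ∨ u J < δ := by
  by_contra! hcon
  obtain ⟨h1, h2⟩ := hcon
  have key : ∀ j ≤ J, u j ≤ (1 / 2 : ℝ) ^ ((1 + κ) ^ j) := by
    intro j
    induction j with
    | zero => intro _; simpa using hhalf
    | succ j ih =>
      intro hj
      have h3 := h1 j (h2.trans (hanti hj))
      refine h3.le.trans ((Real.rpow_le_rpow (hu0 j) (ih (by omega)) (by linarith)).trans ?_)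
      rw [← Real.rpow_mul (by norm_num), pow_succ]
  linarith [key J le_rfl]

/-- The properties of a good split of `A` into two overlapping parts `S` and `A \ S'`, where
`S' ⊆ S` are tails of `A`. -/
lemma card_split {ι : Type*} [DecidableEq ι] {A S S' : Finset ι} {κ δ : ℝ} (hκ : 0 < κ)
    (hδ0 : 0 < δ) (hδ : δ ≤ 1 / 4) (hA : A.Nonempty) (hS : S ⊆ A) (hS' : S' ⊆ S)
    (hhalf : 2 * S.card ≤ A.card) (h1 : δ ≤ (S'.card : ℝ) / A.card)
    (h2 : ((S.card : ℝ) / A.card) ^ (1 + κ) ≤ (S'.card : ℝ) / A.card) :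
    S.Nonempty ∧ (A \ S').Nonempty ∧
      (S.card : ℝ) ^ (1 + κ) + ((A \ S').card : ℝ) ^ (1 + κ) ≤ (A.card : ℝ) ^ (1 + κ) ∧
      (S.card : ℝ) ≤ (1 - δ) * A.card ∧ ((A \ S').card : ℝ) ≤ (1 - δ) * A.card := by
  have hA0 : (0 : ℝ) < A.card := by exact_mod_cast hA.card_pos
  have hcS : S'.card ≤ S.card := Finset.card_le_card hS'
  have hsub : S' ⊆ A := hS'.trans hS
  have hcA : S'.card ≤ A.card := Finset.card_le_card hsub
  have hd : (A \ S').card = A.card - S'.card := Finset.card_sdiff_of_subset hsub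
  have hd' : ((A \ S').card : ℝ) = A.card - S'.card := by rw [hd, Nat.cast_sub hcA]
  rw [le_div_iff₀ hA0] at h1
  have hS'0 : 0 < S'.card := by
    have : (0 : ℝ) < S'.card := lt_of_lt_of_le (by positivity) h1
    exact_mod_cast this
  have hhalf' : 2 * (S.card : ℝ) ≤ A.card := by exact_mod_cast hhalf
  refine ⟨Finset.card_pos.1 (by omega), Finset.card_pos.1 ?_, ?_, by nlinarith, by linarith⟩
  · have := hA.card_pos
    omega
  · set v := (S'.card : ℝ) / A.card with hv
    have hv1 : v ≤ 1 := div_le_one_of_le₀ (by exact_mod_cast hcA) hA0.le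
    have hv0 : 0 ≤ v := by positivity
    have e1 : (S.card : ℝ) = (S.card / A.card : ℝ) * A.card := (div_mul_cancel₀ _ hA0.ne').symm
    have e2 : ((A \ S').card : ℝ) = (1 - v) * A.card := by
      rw [hd', sub_mul, one_mul, hv, div_mul_cancel₀ _ hA0.ne']
    rw [e1, e2, Real.mul_rpow (div_nonneg (Nat.cast_nonneg _) hA0.le) hA0.le,
      Real.mul_rpow (by linarith) hA0.le, ← add_mul]
    have h3 : (1 - v) ^ (1 + κ) ≤ 1 - v := by
      have := Real.rpow_le_rpow_of_exponent_ge' (x := 1 - v) (y := 1 + κ) (z := 1) (by linarith)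
        (by linarith) (by norm_num) (by linarith)
      simpa using this
    exact mul_le_of_le_one_left (Real.rpow_nonneg hA0.le _) (by linarith)

section Tree

variable {n d : ℕ}

/-- Either some coordinate admits a good split of `A`, or at least half of `A` lies in a small
box around the coordinatewise median: if no split is good, the tails beyond the median shrink
doubly exponentially. -/
lemma exists_split_or_box (P : Fin n → Fin d → ℝ) {t : Fin d → ℝ} (ht : ∀ i, 0 < t i)
    {κ : ℝ} (hκ : 0 < κ) {J : ℕ} (hd : 1 ≤ d)
    (hJ : (1 / 2 : ℝ) ^ ((1 + κ) ^ J) < 1 / (4 * d)) {A : Finset (Fin n)} (hA : A.Nonempty) :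
    (∃ (i : Fin d) (s : ℝ) (L R : Finset (Fin n)), L.Nonempty ∧ R.Nonempty ∧
      (L.card : ℝ) ^ (1 + κ) + (R.card : ℝ) ^ (1 + κ) ≤ (A.card : ℝ) ^ (1 + κ) ∧
      (L.card : ℝ) ≤ (1 - 1 / (4 * d)) * A.card ∧ (R.card : ℝ) ≤ (1 - 1 / (4 * d)) * A.card ∧
      ∀ q : ℝ, ∀ j ∈ A, |P j i - q| ≤ t i → (q < s → j ∈ L) ∧ (s ≤ q → j ∈ R)) ∨
    ∃ B ⊆ A, 2 * (A \ B).card ≤ A.card ∧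
      ∀ j ∈ B, ∀ k ∈ B, ∀ i, |P j i - P k i| ≤ (4 * J + 2) * t i := by
  classical
  have hd0 : (1 : ℝ) ≤ d := by exact_mod_cast hd
  have hA0 : (0 : ℝ) < A.card := by exact_mod_cast hA.card_pos
  have hδ0 : (0 : ℝ) < 1 / (4 * d) := by positivity
  have hδ4 : 1 / (4 * d : ℝ) ≤ 1 / 4 := by
    apply one_div_le_one_div_of_le <;> linarith
  choose m hm using fun i => exists_median (fun j => P j i) hA
  -- the upper and lower tails of coordinate `i`, at odd multiples of the width; a threshold at the
  -- even multiple between two consecutive tails is at distance `t i` from both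
  set up : Fin d → ℕ → Finset (Fin n) :=
    fun i j => A.filter fun k => m i + (2 * j + 1) * t i ≤ P k i with hup
  set dn : Fin d → ℕ → Finset (Fin n) :=
    fun i j => A.filter fun k => P k i < m i - (2 * j + 1) * t i with hdn
  have hupA : ∀ i j, up i j ⊆ A := fun i j => Finset.filter_subset _ _
  have hdnA : ∀ i j, dn i j ⊆ A := fun i j => Finset.filter_subset _ _
  have hmono : ∀ i (a b : ℕ), a ≤ b → (2 * (a : ℝ) + 1) * t i ≤ (2 * b + 1) * t i := by
    intro i a b hab
    have : (a : ℝ) ≤ b := by exact_mod_cast hab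
    have := ht i
    gcongr
  have hupanti : ∀ i, Antitone (up i) := by
    intro i a b hab k hk
    simp only [hup, Finset.mem_filter] at hk ⊢
    exact ⟨hk.1, by linarith [hmono i a b hab, hk.2]⟩
  have hdnanti : ∀ i, Antitone (dn i) := by
    intro i a b hab k hk
    simp only [hdn, Finset.mem_filter] at hk ⊢
    exact ⟨hk.1, by linarith [hmono i a b hab, hk.2]⟩
  have hup0 : ∀ i j, 2 * (up i j).card ≤ A.card := by
    intro i j
    refine le_trans (Nat.mul_le_mul_left 2 (Finset.card_le_card fun k hk => ?_)) (hm i).1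
    have hk' := hupanti i (Nat.zero_le j) hk
    simp only [hup, Finset.mem_filter] at hk' ⊢
    refine ⟨hk'.1, ?_⟩
    have := ht i
    have := hk'.2
    push_cast at this
    linarith
  have hdn0 : ∀ i j, 2 * (dn i j).card ≤ A.card := by
    intro i j
    refine le_trans (Nat.mul_le_mul_left 2 (Finset.card_le_card fun k hk => ?_)) (hm i).2
    have hk' := hdnanti i (Nat.zero_le j) hk
    simp only [hdn, Finset.mem_filter] at hk' ⊢
    refine ⟨hk'.1, ?_⟩
    have := ht i
    have := hk'.2
    push_cast at this
    linarith
  have hdich : ∀ S : ℕ → Finset (Fin n), Antitone S → (∀ j, 2 * (S j).card ≤ A.card) →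
      (∃ j, 1 / (4 * d : ℝ) ≤ ((S (j + 1)).card : ℝ) / A.card ∧
        (((S j).card : ℝ) / A.card) ^ (1 + κ) ≤ ((S (j + 1)).card : ℝ) / A.card) ∨
      ((S J).card : ℝ) / A.card < 1 / (4 * d) := by
    intro S hS hS0
    refine exists_slow_drop_or_lt (u := fun j => ((S j).card : ℝ) / A.card) hκ
      (fun j => by positivity) (fun a b hab => ?_) ?_ hJ
    · exact div_le_div_of_nonneg_right (by exact_mod_cast Finset.card_le_card (hS hab)) hA0.le
    · rw [div_le_div_iff₀ hA0 (by norm_num)]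
      have : 2 * ((S 0).card : ℝ) ≤ A.card := by exact_mod_cast hS0 0
      linarith
  by_cases hsplit : (∃ i j, 1 / (4 * d : ℝ) ≤ ((up i (j + 1)).card : ℝ) / A.card ∧
        (((up i j).card : ℝ) / A.card) ^ (1 + κ) ≤ ((up i (j + 1)).card : ℝ) / A.card) ∨
      ∃ i j, 1 / (4 * d : ℝ) ≤ ((dn i (j + 1)).card : ℝ) / A.card ∧
        (((dn i j).card : ℝ) / A.card) ^ (1 + κ) ≤ ((dn i (j + 1)).card : ℝ) / A.card
  · left
    rcases hsplit with ⟨i, j, h1, h2⟩ | ⟨i, j, h1, h2⟩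
    · obtain ⟨c1, c2, c3, c4, c5⟩ := card_split hκ hδ0 hδ4 hA (hupA i j)
        (hupanti i (Nat.le_succ j)) (hup0 i j) h1 h2
      refine ⟨i, m i + (2 * j + 2) * t i, A \ up i (j + 1), up i j, c2, c1, by linarith, c5, c4,
        fun q k hk hq => ⟨fun hqs => ?_, fun hqs => ?_⟩⟩
      · obtain ⟨g1, g2⟩ := abs_le.1 hq
        simp only [hup, Finset.mem_sdiff, Finset.mem_filter, not_and, not_le]
        refine ⟨hk, fun _ => ?_⟩
        push_cast
        linarith
      · obtain ⟨g1, g2⟩ := abs_le.1 hq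
        simp only [hup, Finset.mem_filter]
        exact ⟨hk, by linarith⟩
    · obtain ⟨c1, c2, c3, c4, c5⟩ := card_split hκ hδ0 hδ4 hA (hdnA i j)
        (hdnanti i (Nat.le_succ j)) (hdn0 i j) h1 h2
      refine ⟨i, m i - (2 * j + 2) * t i, dn i j, A \ dn i (j + 1), c1, c2, c3, c4, c5,
        fun q k hk hq => ⟨fun hqs => ?_, fun hqs => ?_⟩⟩
      · obtain ⟨g1, g2⟩ := abs_le.1 hq
        simp only [hdn, Finset.mem_filter]
        exact ⟨hk, by linarith⟩
      · obtain ⟨g1, g2⟩ := abs_le.1 hq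
        simp only [hdn, Finset.mem_sdiff, Finset.mem_filter, not_and, not_lt]
        refine ⟨hk, fun _ => ?_⟩
        push_cast
        linarith
  · right
    push Not at hsplit
    obtain ⟨hs1, hs2⟩ := hsplit
    have hupJ : ∀ i, ((up i J).card : ℝ) / A.card < 1 / (4 * d) := fun i =>
      (hdich (up i) (hupanti i) (hup0 i)).resolve_left fun ⟨j, h1, h2⟩ =>
        absurd h2 (not_le.2 (hs1 i j h1))
    have hdnJ : ∀ i, ((dn i J).card : ℝ) / A.card < 1 / (4 * d) := fun i =>
      (hdich (dn i) (hdnanti i) (hdn0 i)).resolve_left fun ⟨j, h1, h2⟩ =>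
        absurd h2 (not_le.2 (hs2 i j h1))
    refine ⟨A.filter fun k => ∀ i, k ∉ up i J ∧ k ∉ dn i J, Finset.filter_subset _ _, ?_, ?_⟩
    · have hsub : A \ (A.filter fun k => ∀ i, k ∉ up i J ∧ k ∉ dn i J) ⊆
          Finset.univ.biUnion fun i => up i J ∪ dn i J := by
        intro k hk
        simp only [Finset.mem_sdiff, Finset.mem_filter, not_and, not_forall] at hk
        obtain ⟨i, hi⟩ := hk.2 hk.1
        simp only [Finset.mem_biUnion, Finset.mem_univ, true_and, Finset.mem_union]
        exact ⟨i, by tauto⟩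
      have h1 := (Finset.card_le_card hsub).trans Finset.card_biUnion_le
      have h2 : ∀ i ∈ (Finset.univ : Finset (Fin d)),
          ((up i J ∪ dn i J).card : ℝ) ≤ A.card / (2 * d) := by
        intro i _
        have h3 : ((up i J ∪ dn i J).card : ℝ) ≤ (up i J).card + (dn i J).card := by
          exact_mod_cast Finset.card_union_le _ _
        have h4 := hupJ i
        have h5 := hdnJ i
        rw [div_lt_iff₀ hA0] at h4 h5
        have : (A.card : ℝ) / (2 * d) = 1 / (4 * d) * A.card + 1 / (4 * d) * A.card := by
          field_simp
          ring
        linarith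
      have h3 := Finset.sum_le_sum h2
      rw [Finset.sum_const, Finset.card_univ, Fintype.card_fin, nsmul_eq_mul] at h3
      have h4 : (d : ℝ) * (A.card / (2 * d)) = A.card / 2 := by field_simp
      rw [h4] at h3
      have h5 : ((A \ (A.filter fun k => ∀ i, k ∉ up i J ∧ k ∉ dn i J)).card : ℝ) ≤
          ∑ i, ((up i J ∪ dn i J).card : ℝ) := by exact_mod_cast h1
      have h6 : 2 * ((A \ (A.filter fun k => ∀ i, k ∉ up i J ∧ k ∉ dn i J)).card : ℝ) ≤
        A.card := by linarith
      exact_mod_cast h6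
    · intro j hj k hk i
      have hj' := (Finset.mem_filter.1 hj).2 i
      have hk' := (Finset.mem_filter.1 hk).2 i
      have hjA := (Finset.mem_filter.1 hj).1
      have hkA := (Finset.mem_filter.1 hk).1
      simp only [hup, hdn, Finset.mem_filter, hjA, hkA, true_and, not_le, not_lt] at hj' hk'
      rw [abs_le]
      constructor <;> linarith [hj'.1, hj'.2, hk'.1, hk'.2]

/-- A decision tree of almost linear size for near neighbor search in a weighted maximum norm. -/
theorem exists_searchTree (P : Fin n → Fin d → ℝ) {t : Fin d → ℝ} (ht : ∀ i, 0 < t i)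
    {κ : ℝ} (hκ : 0 < κ) {J : ℕ} (hd : 1 ≤ d)
    (hJ : (1 / 2 : ℝ) ^ ((1 + κ) ^ J) < 1 / (4 * d)) (A : Finset (Fin n)) :
    ∃ T : SearchTree n d, (A = ∅ → T = .nil) ∧
      (A.Nonempty → (T.size : ℝ) ≤ 2 * (A.card : ℝ) ^ (1 + κ) - 1 ∧
        (T.cost : ℝ) ≤ 64 * d * (1 + Real.log A.card)) ∧
      ∀ q : Fin d → ℝ, (∃ j ∈ A, ∀ i, |P j i - q i| ≤ t i) →
        ∃ j, T.search P (fun i => (4 * J + 3) * t i) q = some j := by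
  classical
  induction hc : A.card using Nat.strong_induction_on generalizing A with
  | _ a ih =>
    rcases A.eq_empty_or_nonempty with rfl | hA
    · exact ⟨.nil, fun _ => rfl, fun h => absurd h (by simp), fun q ⟨j, hj, _⟩ => by simp at hj⟩
    have hd0 : (1 : ℝ) ≤ d := by exact_mod_cast hd
    have ha : 0 < a := hc ▸ hA.card_pos
    have ha1 : (1 : ℝ) ≤ a := by exact_mod_cast ha
    have hpow : (1 : ℝ) ≤ (a : ℝ) ^ (1 + κ) := Real.one_le_rpow ha1 (by linarith)
    rcases exists_split_or_box P ht hκ hd hJ hA with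
      ⟨i, s, L, R, hL, hR, hsum, hLc, hRc, hnear⟩ | ⟨B, hBA, hB, hbox⟩
    · rw [hc] at hsum hLc hRc
      have hδ : (0 : ℝ) < 1 / (4 * d) := by positivity
      have hδ1 : (1 : ℝ) / (4 * d) < 1 := by
        rw [div_lt_one (by positivity)]
        linarith
      have hlt : ∀ X : Finset (Fin n), (X.card : ℝ) ≤ (1 - 1 / (4 * d)) * a → X.card < a := by
        intro X hX
        have : (X.card : ℝ) < a := by nlinarith
        exact_mod_cast this
      -- either child is smaller by a factor `1 - 1 / (4 * d)`, which pays for the comparison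
      have hcost : ∀ X : Finset (Fin n), X.Nonempty → (X.card : ℝ) ≤ (1 - 1 / (4 * d)) * a →
          64 * d * (1 + Real.log X.card) + 16 ≤ 64 * d * (1 + Real.log a) := by
        intro X hX0 hX
        have hX1 : (0 : ℝ) < X.card := by exact_mod_cast hX0.card_pos
        have h1 : Real.log X.card ≤ Real.log (1 - 1 / (4 * d)) + Real.log a := by
          rw [← Real.log_mul (by linarith) (by positivity)]
          exact Real.log_le_log hX1 hX
        have h2 := Real.log_le_sub_one_of_pos (show (0 : ℝ) < 1 - 1 / (4 * d) by linarith)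
        have h3 : Real.log X.card ≤ Real.log a - 1 / (4 * d) := by linarith
        have h4 : 64 * d * Real.log X.card ≤ 64 * d * (Real.log a - 1 / (4 * d)) :=
          mul_le_mul_of_nonneg_left h3 (by positivity)
        have h5 : 64 * (d : ℝ) * (Real.log a - 1 / (4 * d)) = 64 * d * Real.log a - 16 := by
          field_simp
          ring
        linarith
      obtain ⟨TL, -, hTL, hTLs⟩ := ih L.card (hlt L hLc) L rfl
      obtain ⟨TR, -, hTR, hTRs⟩ := ih R.card (hlt R hRc) R rfl
      obtain ⟨hTL1, hTL2⟩ := hTL hL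
      obtain ⟨hTR1, hTR2⟩ := hTR hR
      refine ⟨.split i s TL TR, fun h => absurd h hA.ne_empty, fun _ => ⟨?_, ?_⟩, ?_⟩
      · simp only [SearchTree.size]
        push_cast
        linarith
      · simp only [SearchTree.cost]
        push_cast
        have h1 := hcost L hL hLc
        have h2 := hcost R hR hRc
        rcases max_choice (TL.cost : ℝ) TR.cost with h | h <;> rw [h] <;> linarith
      · rintro q ⟨j, hj, hq⟩
        obtain ⟨n1, n2⟩ := hnear (q i) j hj (hq i)
        simp only [SearchTree.search]
        split_ifs with hqs
        · exact hTLs q ⟨j, n1 hqs, hq⟩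
        · exact hTRs q ⟨j, n2 (not_lt.1 hqs), hq⟩
    · rw [hc] at hB
      have hBne : B.Nonempty := by
        rw [Finset.nonempty_iff_ne_empty]
        rintro rfl
        simp only [Finset.sdiff_empty, hc] at hB
        omega
      obtain ⟨k, hk⟩ := hBne
      obtain ⟨T, hT0, hT, hTs⟩ := ih (A \ B).card (by omega) (A \ B) rfl
      refine ⟨.ball k T, fun h => absurd h hA.ne_empty, fun _ => ?_, ?_⟩
      · simp only [SearchTree.size, SearchTree.cost]
        push_cast
        have hlog : 0 ≤ Real.log a := Real.log_nonneg ha1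
        rcases (A \ B).eq_empty_or_nonempty with he | he
        · rw [hT0 he]
          simp only [SearchTree.size, SearchTree.cost]
          push_cast
          refine ⟨by linarith, ?_⟩
          have : 0 ≤ 64 * d * Real.log a := by positivity
          linarith
        · obtain ⟨h1, h2⟩ := hT he
          have hX1 : (1 : ℝ) ≤ (A \ B).card := by exact_mod_cast he.card_pos
          have hX2 : 2 * ((A \ B).card : ℝ) ≤ a := by exact_mod_cast hB
          constructor
          · have h3 : 2 * ((A \ B).card : ℝ) ^ (1 + κ) ≤ (a : ℝ) ^ (1 + κ) := by
              refine le_trans ?_ (Real.rpow_le_rpow (by positivity) hX2 (by linarith))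
              rw [Real.mul_rpow (by norm_num) (by positivity)]
              gcongr
              exact Real.self_le_rpow_of_one_le (by norm_num) (by linarith)
            linarith
          -- halving the set gains `64 * d * log 2`, which pays for the test of one point
          · have h3 : Real.log 2 + Real.log (A \ B).card ≤ Real.log a := by
              rw [← Real.log_mul (by norm_num) (by positivity)]
              exact Real.log_le_log (by positivity) hX2
            have h4 := Real.log_two_gt_d9
            have h5 : 64 * (d : ℝ) * (0.6 + Real.log (A \ B).card) ≤ 64 * d * Real.log a :=
              mul_le_mul_of_nonneg_left (by linarith) (by positivity)
            linarith
      · rintro q ⟨j, hj, hq⟩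
        simp only [SearchTree.search]
        split_ifs with hkq
        · exact ⟨k, rfl⟩
        · refine hTs q ⟨j, Finset.mem_sdiff.2 ⟨hj, fun hjB => hkq fun i => ?_⟩, hq⟩
          calc |P k i - q i| ≤ |P k i - P j i| + |P j i - q i| := abs_sub_le _ _ _
            _ ≤ (4 * J + 2) * t i + t i := add_le_add (hbox k hk j hjB i) (hq i)
            _ = (4 * J + 3) * t i := by ring

end Tree

/-! ### The query program -/

namespace RealRAM

/-- The query program. Word registers: `1` holds the constant one, `2` the dimension, `3` the
address of the current node, `4` its tag, `5` an auxiliary address, `6`, `7`, `8` the next three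
fields of the node, `9` the constant zero, `10` the loop counter. Real register `2` holds zero. -/
def annProg : Program := [
  .loadWord 2 0,
  .const 1 1,
  .loadWord 3 1,
  -- instruction 3: read the current node
  .loadWord 4 3,
  .jumpWordLT 4 1 37,
  .wordOp .add 5 3 1,
  .loadWord 6 5,
  .wordOp .add 5 5 1,
  .loadWord 7 5,
  .wordOp .add 5 5 1,
  .loadWord 8 5,
  .jumpWordLT 1 4 19,
  -- instruction 12: split node
  .loadReal 0 3,
  .input 1 6,
  .wordOp .add 3 8 9,
  .jumpRealLT 1 0 17,
  .jump 3,
  .wordOp .add 3 7 9,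
  .jump 3,
  -- instruction 19: ball node
  .const 10 0,
  .jumpWordLT 10 2 22,
  .jump 35,
  .loadReal 0 6,
  .input 1 10,
  .realOp .sub 0 0 1,
  .loadReal 1 7,
  .jumpRealLT 1 0 33,
  .realOp .add 0 0 1,
  .jumpRealLT 0 2 33,
  .wordOp .add 6 6 1,
  .wordOp .add 7 7 1,
  .wordOp .add 10 10 1,
  .jump 20,
  -- instruction 33: the point is too far
  .wordOp .add 3 8 9,
  .jump 3,
  -- instruction 35: the point is close
  .wordOp .add 5 5 1,
  .loadWord 0 5]

variable {w S d : ℕ}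

/-- The number in word cell `a`. -/
def Memory.wordAt (m : Memory w S) (a : ℕ) : ℕ := (fetch m.word a).toNat

/-- The number in real cell `a`. -/
noncomputable def Memory.realAt (m : Memory w S) (a : ℕ) : ℝ := fetch m.real a

/-- The configuration `c` is about to process the node at address `a`. -/
structure AtNode (d : ℕ) (m : Memory w S) (a : ℕ) (c : Config w S) : Prop where
  pc : c.pc = 3
  mem : c.mem = m
  one : (c.wreg 1).toNat = 1
  dim : (c.wreg 2).toNat = d
  addr : (c.wreg 3).toNat = a
  zero : c.wreg 9 = 0
  rzero : c.rreg 2 = 0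

lemma toNat_add_one {x y : BitVec w} {a : ℕ} (hx : x.toNat = a) (hy : y.toNat = 1)
    (h : a + 1 < 2 ^ w) : (x + y).toNat = a + 1 := by
  rw [BitVec.toNat_add, hx, hy, Nat.mod_eq_of_lt h]

lemma atNode_init (q : Fin d → ℝ) (m : Memory w S) (hw : 1 < 2 ^ w) (hd : m.wordAt 0 = d) :
    AtNode d m (m.wordAt 1) ((step annProg q)^[3] (start m)) := by
  have h1 : (1 : ℕ) % 2 ^ w = 1 := Nat.mod_eq_of_lt hw
  simp only [Memory.wordAt] at hd ⊢
  constructor <;>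
    simp [Function.iterate_succ_apply, start, step, annProg, exec, Function.update, hd, h1]

lemma halt_step (q : Fin d → ℝ) {m : Memory w S} {a : ℕ} {c : Config w S} (hc : AtNode d m a c)
    (h : m.wordAt a = 0) : ((step annProg q)^[2] c).pc = 37 := by
  obtain ⟨pc, wr, rr, m'⟩ := c
  obtain ⟨rfl, rfl, h1, h2, h3, h4, h5⟩ := hc
  simp only at *
  simp only [Memory.wordAt] at h
  simp [Function.iterate_succ_apply, step, annProg, exec, Function.update, h1, h3, h]

/-- The configuration `c` has read the fields of the node at address `a`. -/
structure HasRead (d : ℕ) (m : Memory w S) (a : ℕ) (c : Config w S) : Prop where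
  mem : c.mem = m
  one : (c.wreg 1).toNat = 1
  dim : (c.wreg 2).toNat = d
  addr : (c.wreg 3).toNat = a
  next : (c.wreg 5).toNat = a + 3
  fst : (c.wreg 6).toNat = m.wordAt (a + 1)
  snd : (c.wreg 7).toNat = m.wordAt (a + 2)
  trd : (c.wreg 8).toNat = m.wordAt (a + 3)
  zero : c.wreg 9 = 0
  rzero : c.rreg 2 = 0

lemma read_node (q : Fin d → ℝ) {m : Memory w S} {a : ℕ} {c : Config w S} (hc : AtNode d m a c)
    (ha : a + 4 < 2 ^ w) (h : 1 ≤ m.wordAt a) :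
    HasRead d m a ((step annProg q)^[9] c) ∧
      ((step annProg q)^[9] c).pc = if 1 < m.wordAt a then 19 else 12 := by
  obtain ⟨pc, wr, rr, m'⟩ := c
  obtain ⟨rfl, rfl, h1, h2, h3, h4, h5⟩ := hc
  simp only at *
  simp only [Memory.wordAt] at h
  have e1 := toNat_add_one h3 h1 (by omega)
  have e2 := toNat_add_one e1 h1 (by omega)
  have e3 := toNat_add_one e2 h1 (by omega)
  have h' : ¬ (fetch m'.word a).toNat = 0 := by omega
  constructor
  · constructor <;>
      simp [Function.iterate_succ_apply, step, annProg, exec, Function.update, Op.onWord,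
        Memory.wordAt, h1, h2, h3, h4, h5, h', e1, e2, e3]
  · by_cases ht : 1 < (fetch m'.word a).toNat <;>
      simp [Function.iterate_succ_apply, step, annProg, exec, Function.update, Op.onWord,
        Memory.wordAt, h1, h3, h', e1, e2, ht]

lemma split_step (q : Fin d → ℝ) {m : Memory w S} {a : ℕ} {c : Config w S} (hc : AtNode d m a c)
    (ha : a + 4 < 2 ^ w) (h : m.wordAt a = 1) {i : Fin d} (hi : m.wordAt (a + 1) = i) :
    ∃ k ≤ 16, AtNode d m
      (if q i < m.realAt a then m.wordAt (a + 2) else m.wordAt (a + 3))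
      ((step annProg q)^[k] c) := by
  obtain ⟨hr, hpc⟩ := read_node q hc ha h.ge
  rw [h, if_neg (lt_irrefl 1)] at hpc
  have hcomp : ∀ k, (step annProg q)^[k + 9] c =
      (step annProg q)^[k] ((step annProg q)^[9] c) := fun k => Function.iterate_add_apply _ _ _ _
  have hfetch : fetch q (i : ℕ) = q i := by simp [fetch]
  generalize (step annProg q)^[9] c = c' at hr hpc hcomp
  obtain ⟨pc, wr, rr, m'⟩ := c'
  obtain ⟨rfl, h1, h2, h3, h4, h5, h6, h7, h8, h9⟩ := hr
  simp only at *
  subst hpc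
  rw [hi] at h5
  by_cases hq : q i < m'.realAt a
  · refine ⟨6 + 9, by norm_num, ?_⟩
    rw [hcomp, if_pos hq]
    simp only [Memory.realAt] at hq
    constructor <;> simp [Function.iterate_succ_apply, step, annProg, exec, Function.update,
      Op.onWord, h1, h2, h3, h5, h6, h8, h9, hfetch, hq]
  · refine ⟨5 + 9, by norm_num, ?_⟩
    rw [hcomp, if_neg hq]
    simp only [Memory.realAt] at hq
    constructor <;> simp [Function.iterate_succ_apply, step, annProg, exec, Function.update,
      Op.onWord, h1, h2, h3, h5, h7, h8, h9, hfetch, hq]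

/-- The configuration `c` has compared the first `i` coordinates of the point stored at address
`p` with the query, against the widths stored at address `t`. -/
structure InBall (d : ℕ) (m : Memory w S) (a p t i : ℕ) (c : Config w S) : Prop where
  pc : c.pc = 20
  mem : c.mem = m
  one : (c.wreg 1).toNat = 1
  dim : (c.wreg 2).toNat = d
  next : (c.wreg 5).toNat = a + 3
  fst : (c.wreg 6).toNat = p + i
  snd : (c.wreg 7).toNat = t + i
  trd : (c.wreg 8).toNat = m.wordAt (a + 3)
  zero : c.wreg 9 = 0
  counter : (c.wreg 10).toNat = i
  rzero : c.rreg 2 = 0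

lemma ball_coord_pass (q : Fin d → ℝ) {m : Memory w S} {a p t i : ℕ} {c : Config w S}
    (hc : InBall d m a p t i c) (hi : i < d) (hp : p + d < 2 ^ w) (ht : t + d < 2 ^ w)
    (h : |m.realAt (p + i) - q ⟨i, hi⟩| ≤ m.realAt (t + i)) :
    InBall d m a p t (i + 1) ((step annProg q)^[12] c) := by
  obtain ⟨pc, wr, rr, m'⟩ := c
  obtain ⟨rfl, rfl, h1, h2, h3, h4, h5, h6, h7, h8, h9⟩ := hc
  simp only at *
  have hfetch : fetch q i = q ⟨i, hi⟩ := by simp [fetch, hi]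
  have e1 := toNat_add_one h4 h1 (by omega)
  have e2 := toNat_add_one h5 h1 (by omega)
  have e3 := toNat_add_one h8 h1 (by omega)
  simp only [Memory.realAt] at h
  have g1 : ¬ fetch m'.real (t + i) < fetch m'.real (p + i) - q ⟨i, hi⟩ :=
    not_lt.2 (abs_le.1 h).2
  have g2 : ¬ fetch m'.real (p + i) - q ⟨i, hi⟩ + fetch m'.real (t + i) < 0 :=
    not_lt.2 (by linarith [(abs_le.1 h).1])
  constructor <;>
    simp [Function.iterate_succ_apply, step, annProg, exec, Function.update,
      Op.onWord, Op.onReal, -sub_neg, h1, h2, h3, h4, h5, h6, h7, h8, h9, hfetch, hi, e1, e2, e3,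
      g1, g2] <;>
    omega

lemma ball_coord_fail (q : Fin d → ℝ) {m : Memory w S} {a p t i : ℕ} {c : Config w S}
    (hc : InBall d m a p t i c) (hi : i < d)
    (h : ¬ |m.realAt (p + i) - q ⟨i, hi⟩| ≤ m.realAt (t + i)) :
    ∃ k ≤ 10, AtNode d m (m.wordAt (a + 3)) ((step annProg q)^[k] c) := by
  obtain ⟨pc, wr, rr, m'⟩ := c
  obtain ⟨rfl, rfl, h1, h2, h3, h4, h5, h6, h7, h8, h9⟩ := hc
  simp only at *
  have hfetch : fetch q i = q ⟨i, hi⟩ := by simp [fetch, hi]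
  simp only [Memory.realAt] at h
  by_cases g1 : fetch m'.real (t + i) < fetch m'.real (p + i) - q ⟨i, hi⟩
  · refine ⟨8, by norm_num, ?_⟩
    constructor <;>
      simp [Function.iterate_succ_apply, step, annProg, exec, Function.update,
        Op.onWord, Op.onReal, -sub_neg, h1, h2, h4, h5, h6, h7, h8, h9, hfetch, hi, g1]
  · have g2 : fetch m'.real (p + i) - q ⟨i, hi⟩ + fetch m'.real (t + i) < 0 := by
      by_contra! hcon
      exact h (abs_le.2 ⟨by linarith, not_lt.1 g1⟩)
    refine ⟨10, by norm_num, ?_⟩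
    constructor <;>
      simp [Function.iterate_succ_apply, step, annProg, exec, Function.update,
        Op.onWord, Op.onReal, -sub_neg, h1, h2, h4, h5, h6, h7, h8, h9, hfetch, hi, g1, g2]

lemma ball_exit (q : Fin d → ℝ) {m : Memory w S} {a p t : ℕ} {c : Config w S}
    (hc : InBall d m a p t d c) (ha : a + 4 < 2 ^ w) :
    ((step annProg q)^[4] c).pc = 37 ∧ ((step annProg q)^[4] c).output = m.wordAt (a + 4) := by
  obtain ⟨pc, wr, rr, m'⟩ := c
  obtain ⟨rfl, rfl, h1, h2, h3, h4, h5, h6, h7, h8, h9⟩ := hc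
  simp only at *
  have e1 := toNat_add_one h3 h1 (by omega)
  constructor <;>
    simp [Function.iterate_succ_apply, step, annProg, exec, Function.update, Config.output,
        Op.onWord, Memory.wordAt, h2, h8, e1]

lemma ball_enter (q : Fin d → ℝ) {m : Memory w S} {a : ℕ} {c : Config w S} (hc : AtNode d m a c)
    (ha : a + 4 < 2 ^ w) (h : m.wordAt a = 2) :
    InBall d m a (m.wordAt (a + 1)) (m.wordAt (a + 2)) 0 ((step annProg q)^[10] c) := by
  obtain ⟨hr, hpc⟩ := read_node q hc ha (by omega)
  rw [h, if_pos one_lt_two] at hpc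
  rw [show 10 = 1 + 9 from rfl, Function.iterate_add_apply]
  generalize (step annProg q)^[9] c = c' at hr hpc
  obtain ⟨pc, wr, rr, m'⟩ := c'
  obtain ⟨rfl, h1, h2, h3, h4, h5, h6, h7, h8, h9⟩ := hr
  simp only at *
  subst hpc
  constructor <;> simp [step, annProg, exec, Function.update, h1, h2, h4, h5, h6, h7, h8, h9]

lemma ball_step (q : Fin d → ℝ) {m : Memory w S} {a : ℕ} {c : Config w S} (hc : AtNode d m a c)
    (ha : a + 4 < 2 ^ w) (h : m.wordAt a = 2) (hp : m.wordAt (a + 1) + d < 2 ^ w)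
    (ht : m.wordAt (a + 2) + d < 2 ^ w) :
    ∃ k ≤ 12 * d + 24,
      ((∀ i : Fin d, |m.realAt (m.wordAt (a + 1) + i) - q i| ≤ m.realAt (m.wordAt (a + 2) + i)) →
        ((step annProg q)^[k] c).pc = 37 ∧
          ((step annProg q)^[k] c).output = m.wordAt (a + 4)) ∧
      ((¬ ∀ i : Fin d,
          |m.realAt (m.wordAt (a + 1) + i) - q i| ≤ m.realAt (m.wordAt (a + 2) + i)) →
        AtNode d m (m.wordAt (a + 3)) ((step annProg q)^[k] c)) := by
  have henter := ball_enter q hc ha h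
  have hloop : ∀ i ≤ d, (∀ l : Fin d, (l : ℕ) < i →
      |m.realAt (m.wordAt (a + 1) + l) - q l| ≤ m.realAt (m.wordAt (a + 2) + l)) →
      InBall d m a (m.wordAt (a + 1)) (m.wordAt (a + 2)) i
        ((step annProg q)^[12 * i + 10] c) := by
    intro i
    induction i with
    | zero => intro _ _; exact henter
    | succ i ih =>
      intro hi hall
      have h1 := ih (by omega) fun l hl => hall l (by omega)
      rw [show 12 * (i + 1) + 10 = 12 + (12 * i + 10) by ring, Function.iterate_add_apply]
      exact ball_coord_pass q h1 hi hp ht (hall ⟨i, hi⟩ (by simp))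
  by_cases hall : ∀ i : Fin d,
      |m.realAt (m.wordAt (a + 1) + i) - q i| ≤ m.realAt (m.wordAt (a + 2) + i)
  · refine ⟨4 + (12 * d + 10), by omega, fun _ => ?_, fun hn => absurd hall hn⟩
    rw [Function.iterate_add_apply]
    exact ball_exit q (hloop d le_rfl fun l _ => hall l) ha
  · -- the least coordinate that fails the test
    have hex : ∃ i : ℕ, ∃ hi : i < d, ¬ |m.realAt (m.wordAt (a + 1) + i) - q ⟨i, hi⟩| ≤
        m.realAt (m.wordAt (a + 2) + i) := by
      push Not at hall ⊢
      obtain ⟨i, hi⟩ := hall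
      exact ⟨i, i.2, hi⟩
    classical
    obtain ⟨hi, hfail⟩ := Nat.find_spec hex
    have hbefore := hloop (Nat.find hex) hi.le fun l hl => by
      have := Nat.find_min hex hl
      push Not at this
      exact this l.2
    obtain ⟨k, hk, hat⟩ := ball_coord_fail q hbefore hi hfail
    refine ⟨k + (12 * Nat.find hex + 10), by omega, fun h => absurd h hall, fun _ => ?_⟩
    rwa [Function.iterate_add_apply]

end RealRAM

/-! ### Search trees in memory -/

namespace RealRAM

/-- A node record: five word cells and one real cell. The tag is `0` for the end of the search,
`1` for a split (`f1` coordinate, `f2` and `f3` addresses of the children, `thr` threshold) and `2`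
for a ball (`f1` address of the point, `f2` address of the widths, `f3` address of the child, `f4`
index of the point). The record with number `k` has address `5 * k`. -/
structure Node where
  tag : ℕ
  f1 : ℕ
  f2 : ℕ
  f3 : ℕ
  f4 : ℕ
  thr : ℝ

/-- All word fields of a node are at most `B`. -/
structure Node.Bounded (B : ℕ) (v : Node) : Prop where
  tag : v.tag ≤ B
  f1 : v.f1 ≤ B
  f2 : v.f2 ≤ B
  f3 : v.f3 ≤ B
  f4 : v.f4 ≤ B

variable {w S n d R : ℕ}

/-- The number of the root of a tree placed from record `b` on, where the empty tree stands for
the record `e` at which the search continues. -/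
def root (b e : ℕ) : SearchTree n d → ℕ
  | .nil => e
  | _ => b

/-- The records of a tree placed from record `b` on; unsuccessful searches continue at record `e`.
The points have addresses `pt`, the widths have address `tb`. -/
def encode (pt : Fin n → ℕ) (tb : ℕ) : SearchTree n d → ℕ → ℕ → List Node
  | .nil, _, _ => []
  | .split i s l r, b, e =>
      ⟨1, i, 5 * root (b + 1) e l, 5 * root (b + 1 + l.size) e r, 0, s⟩ ::
        (encode pt tb l (b + 1) e ++ encode pt tb r (b + 1 + l.size) e)
  | .ball j t, b, e =>
      ⟨2, pt j, tb, 5 * root (b + 1) e t, j, 0⟩ :: encode pt tb t (b + 1) e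

/-- The records of a sequence of trees that are searched one after the other. -/
def encodeAll (pt : Fin n → ℕ) (tb : Fin R → ℕ) (T : Fin R → SearchTree n d) :
    List (Fin R) → ℕ → List Node
  | [], _ => [⟨0, 0, 0, 0, 0, 0⟩]
  | r :: rs, b =>
      encode pt (tb r) (T r) b (b + (T r).size) ++ encodeAll pt tb T rs (b + (T r).size)

lemma length_encode (pt : Fin n → ℕ) (tb : ℕ) (T : SearchTree n d) (b e : ℕ) :
    (encode pt tb T b e).length = T.size := by
  induction T generalizing b with
  | nil => rfl
  | split i s l r ihl ihr => simp [encode, SearchTree.size, ihl, ihr]; omega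
  | ball j t ih => simp [encode, SearchTree.size, ih]; omega

lemma length_encodeAll (pt : Fin n → ℕ) (tb : Fin R → ℕ) (T : Fin R → SearchTree n d)
    (rs : List (Fin R)) (b : ℕ) :
    (encodeAll pt tb T rs b).length = (rs.map fun r => (T r).size).sum + 1 := by
  induction rs generalizing b with
  | nil => rfl
  | cons r rs ih => simp [encodeAll, length_encode, ih]; omega

lemma root_le {b e B : ℕ} {T : SearchTree n d} (hb : b + T.size ≤ B) (he : e ≤ B) :
    root b e T ≤ B := by
  cases T <;> simp only [root] <;> omega

lemma encode_bounded {pt : Fin n → ℕ} {tb : ℕ} {T : SearchTree n d} {b e B : ℕ}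
    (hpt : ∀ j, pt j ≤ B) (htb : tb ≤ B) (hn : n ≤ B) (hd : d ≤ B) (h2 : 2 ≤ B)
    (hb : 5 * (b + T.size) ≤ B) (he : 5 * e ≤ B) :
    ∀ v ∈ encode pt tb T b e, v.Bounded B := by
  induction T generalizing b with
  | nil => simp [encode]
  | split i s l r ihl ihr =>
    simp only [SearchTree.size] at hb
    intro v hv
    simp only [encode, List.mem_cons, List.mem_append] at hv
    have h3 : root (b + 1) e l ≤ B / 5 := root_le (by omega) (by omega)
    have h4 : root (b + 1 + l.size) e r ≤ B / 5 := root_le (by omega) (by omega)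
    rcases hv with rfl | hv | hv
    · have := i.2
      constructor <;> simp only <;> omega
    · exact ihl (by omega) v hv
    · exact ihr (by omega) v hv
  | ball j t ih =>
    simp only [SearchTree.size] at hb
    intro v hv
    simp only [encode, List.mem_cons] at hv
    have h3 : root (b + 1) e t ≤ B / 5 := root_le (by omega) (by omega)
    rcases hv with rfl | hv
    · have := j.2
      have := hpt j
      constructor <;> simp only <;> omega
    · exact ih (by omega) v hv

lemma encodeAll_bounded {pt : Fin n → ℕ} {tb : Fin R → ℕ} {T : Fin R → SearchTree n d}
    {rs : List (Fin R)} {b B : ℕ} (hpt : ∀ j, pt j ≤ B) (htb : ∀ r, tb r ≤ B) (hn : n ≤ B)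
    (hd : d ≤ B) (h2 : 2 ≤ B) (hb : 5 * (b + (rs.map fun r => (T r).size).sum) ≤ B) :
    ∀ v ∈ encodeAll pt tb T rs b, v.Bounded B := by
  induction rs generalizing b with
  | nil =>
    intro v hv
    simp only [encodeAll, List.mem_singleton] at hv
    subst hv
    constructor <;> simp
  | cons r rs ih =>
    simp only [List.map_cons, List.sum_cons] at hb
    intro v hv
    simp only [encodeAll, List.mem_append] at hv
    rcases hv with hv | hv
    · exact encode_bounded hpt (htb r) hn hd h2 (by omega) (by omega) v hv
    · exact ih (by omega) v hv

/-- The node `v` is stored in memory as record `k`. -/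
structure Stored (m : Memory w S) (k : ℕ) (v : Node) : Prop where
  tag : m.wordAt (5 * k) = v.tag
  f1 : m.wordAt (5 * k + 1) = v.f1
  f2 : m.wordAt (5 * k + 2) = v.f2
  f3 : m.wordAt (5 * k + 3) = v.f3
  f4 : m.wordAt (5 * k + 4) = v.f4
  thr : m.realAt (5 * k) = v.thr

/-- The nodes of the list `L` are stored in memory as consecutive records from `b` on. -/
def StoredFrom (m : Memory w S) : ℕ → List Node → Prop
  | _, [] => True
  | b, v :: L => Stored m b v ∧ StoredFrom m (b + 1) L

lemma storedFrom_append {m : Memory w S} {b : ℕ} {L L' : List Node} :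
    StoredFrom m b (L ++ L') ↔ StoredFrom m b L ∧ StoredFrom m (b + L.length) L' := by
  induction L generalizing b with
  | nil => simp [StoredFrom]
  | cons v L ih =>
    simp only [List.cons_append, StoredFrom, ih, List.length_cons, and_assoc]
    rw [show b + 1 + L.length = b + (L.length + 1) by ring]

lemma storedFrom_of_get {m : Memory w S} {b : ℕ} {L : List Node}
    (h : ∀ (i : ℕ) (hi : i < L.length), Stored m (b + i) L[i]) : StoredFrom m b L := by
  induction L generalizing b with
  | nil => trivial
  | cons v L ih =>
    refine ⟨h 0 (by simp), ih fun i hi => ?_⟩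
    have := h (i + 1) (by simpa using hi)
    rwa [show b + (i + 1) = b + 1 + i by ring] at this

/-- A search in a stored tree either halts with the point that it finds or arrives at the record
`e`. -/
lemma run_encode {P : Fin n → Fin d → ℝ} {τ : Fin d → ℝ} {pt : Fin n → ℕ} {tb : ℕ}
    {m : Memory w S} (hpt : ∀ j, pt j + d < 2 ^ w) (htb : tb + d < 2 ^ w)
    (hP : ∀ j (i : Fin d), m.realAt (pt j + i) = P j i)
    (hτ : ∀ i : Fin d, m.realAt (tb + i) = τ i) (q : Fin d → ℝ) (T : SearchTree n d) {b e : ℕ}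
    (hb : 5 * (b + T.size) < 2 ^ w) (hs : StoredFrom m b (encode pt tb T b e)) {c : Config w S}
    (hc : AtNode d m (5 * root b e T) c) :
    ∃ k ≤ T.cost,
      (∃ j, T.search P τ q = some j ∧ ((step annProg q)^[k] c).pc = 37 ∧
        ((step annProg q)^[k] c).output = j) ∨
      T.search P τ q = none ∧ AtNode d m (5 * e) ((step annProg q)^[k] c) := by
  induction T generalizing b c with
  | nil => exact ⟨0, le_rfl, .inr ⟨rfl, hc⟩⟩
  | split i s l r ihl ihr =>
    simp only [SearchTree.size] at hb
    simp only [encode, StoredFrom, storedFrom_append, length_encode] at hs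
    obtain ⟨hv, hl, hr⟩ := hs
    simp only [root] at hc
    obtain ⟨k, hk, hat⟩ := split_step q hc (by omega) hv.tag hv.f1
    rw [hv.thr, hv.f2, hv.f3] at hat
    simp only [SearchTree.cost, SearchTree.search]
    by_cases hq : q i < s
    · simp only [hq, if_true] at hat ⊢
      obtain ⟨k', hk', h⟩ := ihl (by omega) hl hat
      simp only [← Function.iterate_add_apply] at h
      exact ⟨k' + k, by omega, h⟩
    · simp only [hq, if_false] at hat ⊢
      obtain ⟨k', hk', h⟩ := ihr (by omega) hr hat
      simp only [← Function.iterate_add_apply] at h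
      exact ⟨k' + k, by omega, h⟩
  | ball j t ih =>
    simp only [SearchTree.size] at hb
    simp only [encode, StoredFrom] at hs
    obtain ⟨hv, ht⟩ := hs
    simp only [root] at hc
    obtain ⟨k, hk, h1, h2⟩ := ball_step q hc (by omega) hv.tag (by rw [hv.f1]; exact hpt j)
      (by rw [hv.f2]; exact htb)
    rw [hv.f1, hv.f2] at h1 h2
    simp only [hP, hτ] at h1 h2
    rw [hv.f4] at h1
    rw [hv.f3] at h2
    simp only [SearchTree.cost, SearchTree.search]
    by_cases hq : ∀ i, |P j i - q i| ≤ τ i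
    · exact ⟨k, by omega, .inl ⟨j, by rw [if_pos hq], h1 hq⟩⟩
    · simp only [hq, if_false]
      obtain ⟨k', hk', h⟩ := ih (by omega) ht (h2 hq)
      simp only [← Function.iterate_add_apply] at h
      exact ⟨k' + k, by omega, h⟩

lemma run_encodeAll {P : Fin n → Fin d → ℝ} {τ : Fin R → Fin d → ℝ} {pt : Fin n → ℕ}
    {tb : Fin R → ℕ} {m : Memory w S} (hpt : ∀ j, pt j + d < 2 ^ w) (htb : ∀ r, tb r + d < 2 ^ w)
    (hP : ∀ j (i : Fin d), m.realAt (pt j + i) = P j i)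
    (hτ : ∀ r, ∀ i : Fin d, m.realAt (tb r + i) = τ r i) (q : Fin d → ℝ)
    (T : Fin R → SearchTree n d) (rs : List (Fin R)) {b : ℕ}
    (hb : 5 * (b + (rs.map fun r => (T r).size).sum) < 2 ^ w)
    (hs : StoredFrom m b (encodeAll pt tb T rs b)) {c : Config w S}
    (hc : AtNode d m (5 * b) c) :
    ∃ k ≤ (rs.map fun r => (T r).cost).sum + 2, ((step annProg q)^[k] c).pc = 37 ∧
      ((∃ r j, (T r).search P (τ r) q = some j ∧ ((step annProg q)^[k] c).output = j) ∨
      ∀ r ∈ rs, (T r).search P (τ r) q = none) := by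
  induction rs generalizing b c with
  | nil =>
    simp only [encodeAll, StoredFrom, and_true] at hs
    exact ⟨2, by simp, halt_step q hc hs.tag, .inr (by simp)⟩
  | cons r rs ih =>
    simp only [List.map_cons, List.sum_cons] at hb ⊢
    simp only [encodeAll, storedFrom_append, length_encode] at hs
    have hroot : root b (b + (T r).size) (T r) = b := by
      cases T r <;> simp [root, SearchTree.size]
    rw [← hroot] at hc
    obtain ⟨k, hk, h⟩ := run_encode hpt (htb r) hP (hτ r) q (T r) (by omega) hs.1 hc
    rcases h with ⟨j, hj, hpc, hout⟩ | ⟨hnone, hat⟩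
    · exact ⟨k, by omega, hpc, .inl ⟨r, j, hj, hout⟩⟩
    · obtain ⟨k', hk', hpc, h⟩ := ih (by omega) hs.2 hat
      refine ⟨k' + k, by omega, ?_⟩
      rw [Function.iterate_add_apply]
      refine ⟨hpc, h.imp id fun h r' hr' => ?_⟩
      rcases List.mem_cons.1 hr' with rfl | hr'
      · exact hnone
      · exact h r' hr'

lemma step_mem (q : Fin d → ℝ) (c : Config w S) : (step annProg q c).mem = c.mem := by
  have key : ∀ i ∈ annProg, (exec q c i).mem = c.mem := by
    intro i hi
    simp only [annProg, List.mem_cons, List.not_mem_nil, or_false] at hi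
    rcases hi with rfl | rfl | rfl | rfl | rfl | rfl | rfl | rfl | rfl | rfl | rfl | rfl | rfl |
      rfl | rfl | rfl | rfl | rfl | rfl | rfl | rfl | rfl | rfl | rfl | rfl | rfl | rfl | rfl |
      rfl | rfl | rfl | rfl | rfl | rfl | rfl | rfl | rfl <;> rfl
  unfold step
  split
  · next i hi => exact key i (List.mem_of_getElem? hi)
  · rfl

/-- The query program never writes to memory. -/
lemma run_mem (m : Memory w S) (q : Fin d → ℝ) (t : ℕ) : (run annProg m q t).mem = m := by
  unfold run
  induction t with
  | zero => rfl
  | succ t ih => rw [Function.iterate_succ_apply', step_mem, ih]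

/-- A halted machine stays as it is. -/
lemma run_eq_of_halted {m : Memory w S} {q : Fin d → ℝ} {k t : ℕ} (hkt : k ≤ t)
    (h : (run annProg m q k).pc = 37) : run annProg m q t = run annProg m q k := by
  obtain ⟨l, rfl⟩ := Nat.exists_eq_add_of_le hkt
  have hfix : step annProg q (run annProg m q k) = run annProg m q k := by
    unfold step
    rw [h]
    rfl
  unfold run at hfix ⊢
  rw [add_comm, Function.iterate_add_apply, Function.iterate_fixed hfix]

/-- The word cell `i` of a memory that holds the records `L`. -/
def Node.field (L : List Node) (i : ℕ) : ℕ :=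
  match L[i / 5]? with
  | none => 0
  | some v => if i % 5 = 0 then v.tag else if i % 5 = 1 then v.f1 else if i % 5 = 2 then v.f2
      else if i % 5 = 3 then v.f3 else v.f4

lemma Node.field_le {L : List Node} {B : ℕ} (h : ∀ v ∈ L, v.Bounded B) (i : ℕ) :
    Node.field L i ≤ B := by
  unfold Node.field
  split
  · exact Nat.zero_le _
  · next v hv =>
    have := h v (List.mem_of_getElem? hv)
    split_ifs
    · exact this.tag
    · exact this.f1
    · exact this.f2
    · exact this.f3
    · exact this.f4

/-- The memory with the records `L` in its first `M` records, and with the real data `D` behind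
the thresholds of these records. -/
noncomputable def layout (w S M : ℕ) (L : List Node) (D : ℕ → ℝ) : Memory w S where
  word i := BitVec.ofNat w (Node.field L i)
  real i := if (i : ℕ) < 5 * M then (L[(i : ℕ) / 5]?.map Node.thr).getD 0 else D (i - 5 * M)

lemma layout_stored {M : ℕ} {L : List Node} {D : ℕ → ℝ} {B : ℕ} (hL : ∀ v ∈ L, v.Bounded B)
    (hB : B < 2 ^ w) (hM : L.length ≤ M) (hS : 5 * M ≤ S) :
    StoredFrom (layout w S M L D) 0 L := by
  refine storedFrom_of_get fun i hi => ?_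
  have hword : ∀ l < 5, (layout w S M L D).wordAt (5 * (0 + i) + l) =
      Node.field L (5 * i + l) := by
    intro l hl
    have h1 : 5 * i + l < S := by omega
    simp only [Memory.wordAt, fetch, layout, zero_add, dif_pos h1, BitVec.toNat_ofNat]
    exact Nat.mod_eq_of_lt ((Node.field_le hL _).trans_lt hB)
  have hdiv : ∀ l < 5, (5 * i + l) / 5 = i := fun l hl => by omega
  have hmod : ∀ l < 5, (5 * i + l) % 5 = l := fun l hl => by omega
  have hget : L[i]? = some L[i] := List.getElem?_eq_getElem hi
  have h0 := hword 0 (by norm_num)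
  have h1 := hword 1 (by norm_num)
  have h2 := hword 2 (by norm_num)
  have h3 := hword 3 (by norm_num)
  have h4 := hword 4 (by norm_num)
  rw [Node.field, hdiv _ (by norm_num), hmod _ (by norm_num), hget] at h0 h1 h2 h3 h4
  refine ⟨h0, h1, h2, h3, h4, ?_⟩
  have h5 : 5 * i < S := by omega
  have h6 : 5 * i < 5 * M := by omega
  simp [Memory.realAt, fetch, layout, h5, h6, hget]

lemma layout_realAt {M : ℕ} {L : List Node} {D : ℕ → ℝ} {i : ℕ} (hi : 5 * M + i < S) :
    (layout w S M L D).realAt (5 * M + i) = D i := by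
  simp [Memory.realAt, fetch, layout, hi]

/-- Any sequence of search trees, each with its own widths, can be stored such that the query
program searches them one after the other. -/
theorem exists_memory (P : Fin n → Fin d → ℝ) (T : Fin R → SearchTree n d)
    (τ : Fin R → Fin d → ℝ) (hn : 0 < n) (hd : 0 < d) {M : ℕ}
    (hM : (∑ r, (T r).size) + 2 ≤ M)
    (hS : S = 5 * M + (n + R) * d) (hw : S < 2 ^ w) :
    ∃ m : Memory w S, ∀ q : Fin d → ℝ, ∃ k ≤ (∑ r, (T r).cost) + 5,
      (run annProg m q k).pc = 37 ∧
      ((∃ r j, (T r).search P (τ r) q = some j ∧ (run annProg m q k).output = j) ∨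
        ∀ r, (T r).search P (τ r) q = none) := by
  set pt : Fin n → ℕ := fun j => 5 * M + j * d with hpt
  set tb : Fin R → ℕ := fun r => 5 * M + (n + r) * d with htb
  set L : List Node := ⟨d, 5, 0, 0, 0, 0⟩ :: encodeAll pt tb T (List.finRange R) 1 with hL
  -- the points, then the widths, each as a row of `d` cells
  set D : ℕ → ℝ := fun a =>
    if h : a / d < n then P ⟨a / d, h⟩ ⟨a % d, Nat.mod_lt _ hd⟩
    else if h : a / d - n < R then τ ⟨a / d - n, h⟩ ⟨a % d, Nat.mod_lt _ hd⟩ else 0 with hD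
  have hsum : ((List.finRange R).map fun r => (T r).size).sum = ∑ r, (T r).size :=
    (Fin.sum_univ_def _).symm
  have hcost : ((List.finRange R).map fun r => (T r).cost).sum = ∑ r, (T r).cost :=
    (Fin.sum_univ_def _).symm
  have hrow : ∀ a b c : ℕ, a < b → a * c + c ≤ b * c := fun a b c hab => by
    rw [← Nat.succ_mul]
    exact Nat.mul_le_mul_right c hab
  have hdS : n ≤ (n + R) * d := (Nat.le_add_right n R).trans (Nat.le_mul_of_pos_right _ hd)
  have hptS : ∀ j, pt j + d ≤ S := fun j => by
    have := hrow j (n + R) d (by omega)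
    simp only [hpt]
    omega
  have htbS : ∀ r, tb r + d ≤ S := fun r => by
    have := hrow (n + r) (n + R) d (by omega)
    simp only [htb]
    omega
  have hdle : d ≤ (n + R) * d := Nat.le_mul_of_pos_left _ (by omega)
  have hbd : ∀ v ∈ L, v.Bounded S := by
    intro v hv
    rcases List.mem_cons.1 hv with rfl | hv
    · constructor <;> simp only <;> omega
    · exact encodeAll_bounded (fun j => by have := hptS j; omega)
        (fun r => by have := htbS r; omega) (by omega) (by omega) (by omega)
        (by rw [hsum]; omega) v hv
  have hlen : L.length ≤ M := by
    rw [hL, List.length_cons, length_encodeAll, hsum]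
    omega
  have hst := layout_stored (w := w) (S := S) (D := D) hbd hw hlen (by omega)
  rw [hL] at hst
  obtain ⟨hhead, htail⟩ := hst
  have hdiv : ∀ (a : ℕ) (i : Fin d), (a * d + i) / d = a := fun a i => by
    rw [add_comm, Nat.add_mul_div_right _ _ hd, Nat.div_eq_of_lt i.2, zero_add]
  have hmod : ∀ (a : ℕ) (i : Fin d), (a * d + i) % d = i := fun a i => by
    rw [add_comm, Nat.add_mul_mod_self_right, Nat.mod_eq_of_lt i.2]
  have hP : ∀ j (i : Fin d), (layout w S M L D).realAt (pt j + i) = P j i := by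
    intro j i
    have h1 := hptS j
    have h2 := i.2
    simp only [hpt] at h1 ⊢
    rw [add_assoc, layout_realAt (by omega)]
    simp only [hD, hdiv, hmod, j.2, dif_pos]
  have hτ : ∀ r (i : Fin d), (layout w S M L D).realAt (tb r + i) = τ r i := by
    intro r i
    have h1 := htbS r
    have h2 := i.2
    simp only [htb] at h1 ⊢
    rw [add_assoc, layout_realAt (by omega)]
    simp only [hD, hdiv, hmod]
    simp
  refine ⟨layout w S M L D, fun q => ?_⟩
  have hinit := atNode_init q (layout w S M L D) (by omega) hhead.tag
  have hroot : (layout w S M L D).wordAt 1 = 5 * 1 := hhead.f1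
  rw [hroot] at hinit
  obtain ⟨k, hk, hpc, hout⟩ := run_encodeAll (fun j => (hptS j).trans_lt hw)
    (fun r => (htbS r).trans_lt hw) hP hτ q T (List.finRange R) (by rw [hsum]; omega) htail hinit
  rw [← Function.iterate_add_apply] at hpc hout
  refine ⟨k + 3, by omega, hpc, hout.imp id fun h r => h r (List.mem_finRange r)⟩

end RealRAM

/-! ### Random widths -/

open MeasureTheory in
/-- A random positive number whose tail is `exp (-lam * G)`, up to a factor two in the argument. -/
lemma exists_random_width {G : ℝ≥0 → ℝ≥0} (hG : Monotone G)
    (hGtop : Filter.Tendsto G Filter.atTop Filter.atTop) (hG0 : ∃ δ : ℝ≥0, 0 < δ ∧ G δ = 0)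
    {lam : ℝ} (hlam : 0 < lam) :
    ∃ (ν : Measure ℝ) (t : ℝ → ℝ), IsProbabilityMeasure ν ∧ (∀ u, 0 < t u) ∧
      (∀ x : ℝ, ∃ A : Set ℝ, MeasurableSet A ∧ (∀ u ∈ A, |x| ≤ t u) ∧
        ENNReal.ofReal (Real.exp (-lam * G ‖x‖₊)) ≤ ν A) ∧
      ∀ (x D : ℝ), 0 < D →
        ν {u | |x| ≤ D * t u} ≤ ENNReal.ofReal (Real.exp (-lam * G ‖x / (2 * D)‖₊)) := by
  obtain ⟨δ, hδ, hGδ⟩ := hG0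
  -- up to a factor two, `t` is the largest `s` with `u ≤ exp (-lam * G s)`
  have hex : ∀ u : ℝ, ∃ t : ℝ, 0 < t ∧ (0 < u → u ≤ 1 →
      (∀ s : ℝ≥0, u ≤ Real.exp (-lam * G s) → (s : ℝ) ≤ t) ∧
      ∀ s : ℝ≥0, (s : ℝ) ≤ t / 2 → u ≤ Real.exp (-lam * G s)) := by
    intro u
    by_cases hu : 0 < u ∧ u ≤ 1
    swap
    · exact ⟨1, one_pos, fun h1 h2 => absurd ⟨h1, h2⟩ hu⟩
    set E : Set ℝ≥0 := {s | u ≤ Real.exp (-lam * G s)} with hE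
    have hδE : δ ∈ E := by simp [hE, hGδ, hu.2]
    have hbdd : BddAbove E := by
      obtain ⟨s₀, hs₀⟩ := (hGtop.eventually_gt_atTop (Real.toNNReal (-Real.log u / lam))).exists
      refine ⟨s₀, fun s hs => ?_⟩
      by_contra! hlt
      have h1 : Real.log u ≤ -lam * G s := by
        rw [Real.log_le_iff_le_exp hu.1]
        exact hs
      have h2 : -Real.log u / lam < G s₀ := (Real.le_coe_toNNReal _).trans_lt (by exact_mod_cast hs₀)
      rw [div_lt_iff₀ hlam] at h2
      have h3 : (G s₀ : ℝ) ≤ G s := by exact_mod_cast hG hlt.le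
      nlinarith
    have hpos : 0 < sSup E := hδ.trans_le (le_csSup hbdd hδE)
    refine ⟨(sSup E : ℝ≥0), by exact_mod_cast hpos, fun _ _ => ⟨fun s hs => ?_, fun s hs => ?_⟩⟩
    · exact_mod_cast le_csSup hbdd hs
    · have h1 : s < sSup E := by
        rw [← NNReal.coe_lt_coe]
        have : (0 : ℝ) < (sSup E : ℝ≥0) := by exact_mod_cast hpos
        linarith
      obtain ⟨s', hs', hlt⟩ := exists_lt_of_lt_csSup ⟨δ, hδE⟩ h1
      refine le_trans (show u ≤ _ from hs') (Real.exp_le_exp.2 ?_)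
      have h3 : (G s : ℝ) ≤ G s' := by exact_mod_cast hG hlt.le
      nlinarith
  choose t ht0 ht using hex
  have hprob : IsProbabilityMeasure (volume.restrict (Set.Ioc (0 : ℝ) 1)) :=
    ⟨by simp⟩
  have hle1 : ∀ s, Real.exp (-lam * G s) ≤ 1 := fun s => by
    rw [Real.exp_le_one_iff]
    have : (0 : ℝ) ≤ G s := (G s).2
    nlinarith
  refine ⟨volume.restrict (Set.Ioc (0 : ℝ) 1), t, hprob, ht0, fun x => ?_, fun x D hD => ?_⟩
  · refine ⟨Set.Ioc 0 (Real.exp (-lam * G ‖x‖₊)), measurableSet_Ioc, fun u hu => ?_, ?_⟩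
    · have := (ht u hu.1 (hu.2.trans (hle1 _))).1 _ hu.2
      simpa using this
    · rw [Measure.restrict_apply' measurableSet_Ioc,
        Set.inter_eq_left.2 (Set.Ioc_subset_Ioc_right (hle1 _)), Real.volume_Ioc, sub_zero]
  · rw [Measure.restrict_apply' measurableSet_Ioc]
    refine (measure_mono (t := Set.Ioc 0 (Real.exp (-lam * G ‖x / (2 * D)‖₊))) ?_).trans
      (by rw [Real.volume_Ioc, sub_zero])
    rintro u ⟨hu, hu0, hu1⟩
    refine ⟨hu0, (ht u hu0 hu1).2 _ ?_⟩
    have hu' : |x| ≤ D * t u := hu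
    rw [coe_nnnorm, Real.norm_eq_abs, abs_div, abs_of_pos (show 0 < 2 * D by linarith),
      div_le_div_iff₀ (by linarith) (by norm_num)]
    linarith

open MeasureTheory in
/-- Independent random widths for all coordinates: the box with these half-widths contains `x` with
probability about `exp (-lam * ∑ i, G |x i|)`. -/
lemma exists_random_widths {G : ℝ≥0 → ℝ≥0} (hG : Monotone G)
    (hGtop : Filter.Tendsto G Filter.atTop Filter.atTop) (hG0 : ∃ δ : ℝ≥0, 0 < δ ∧ G δ = 0)
    {lam : ℝ} (hlam : 0 < lam) (d : ℕ) :
    ∃ (μ : Measure (Fin d → ℝ)) (t : (Fin d → ℝ) → Fin d → ℝ), IsProbabilityMeasure μ ∧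
      (∀ ω i, 0 < t ω i) ∧
      (∀ x : Fin d → ℝ, ∃ A : Set (Fin d → ℝ), MeasurableSet A ∧ (∀ ω ∈ A, ∀ i, |x i| ≤ t ω i) ∧
        ENNReal.ofReal (Real.exp (-lam * ∑ i, (G ‖x i‖₊ : ℝ))) ≤ μ A) ∧
      ∀ (x : Fin d → ℝ) (D : ℝ), 0 < D → μ {ω | ∀ i, |x i| ≤ D * t ω i} ≤
        ENNReal.ofReal (Real.exp (-lam * ∑ i, (G ‖x i / (2 * D)‖₊ : ℝ))) := by
  obtain ⟨ν, t, hν, ht0, hnear, hfar⟩ := exists_random_width hG hGtop hG0 hlam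
  have hexp : ∀ f : Fin d → ℝ, ENNReal.ofReal (Real.exp (-lam * ∑ i, f i)) =
      ∏ i, ENNReal.ofReal (Real.exp (-lam * f i)) := fun f => by
    rw [Finset.mul_sum, Real.exp_sum, ENNReal.ofReal_prod_of_nonneg fun i _ => (Real.exp_pos _).le]
  refine ⟨Measure.pi fun _ => ν, fun ω i => t (ω i), inferInstance, fun ω i => ht0 _, fun x => ?_,
    fun x D hD => ?_⟩
  · choose A hA hAx hAν using hnear
    refine ⟨Set.pi Set.univ fun i => A (x i), MeasurableSet.univ_pi fun i => hA _,
      fun ω hω i => hAx _ _ (hω i (Set.mem_univ i)), ?_⟩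
    rw [Measure.pi_pi, hexp]
    exact Finset.prod_le_prod' fun i _ => hAν _
  · have : {ω : Fin d → ℝ | ∀ i, |x i| ≤ D * t (ω i)} =
        Set.pi Set.univ fun i => {u | |x i| ≤ D * t u} := by
      ext ω
      simp
    rw [this, Measure.pi_pi, hexp]
    exact Finset.prod_le_prod' fun i _ => hfar _ _ hD

open MeasureTheory in
/-- Independent repetition: the event `A` occurs in some of `R` copies, and the events `F j` occur
in none, except with the probability given by independence and the union bound. -/
lemma measure_pi_fail_le {Ω : Type*} [MeasurableSpace Ω] {μ : Measure Ω} [IsProbabilityMeasure μ]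
    {n R : ℕ} {A : Set Ω} (hA : MeasurableSet A) {F : Fin n → Set Ω} {a b : ℝ} (ha : 0 ≤ a)
    (ha1 : a ≤ 1) (hb : 0 ≤ b) (hμA : ENNReal.ofReal a ≤ μ A) {J : Finset (Fin n)}
    (hμF : ∀ j ∈ J, μ (F j) ≤ ENNReal.ofReal b) :
    Measure.pi (fun _ : Fin R => μ) {ω | (∀ r, ω r ∉ A) ∨ ∃ r, ∃ j ∈ J, ω r ∈ F j} ≤
      ENNReal.ofReal (Real.exp (-(a * R)) + R * n * b) := by
  have hsub : {ω : Fin R → Ω | (∀ r, ω r ∉ A) ∨ ∃ r, ∃ j ∈ J, ω r ∈ F j} ⊆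
      (Set.pi Set.univ fun _ => Aᶜ) ∪ ⋃ r ∈ (Finset.univ : Finset (Fin R)), ⋃ j ∈ J,
        Set.pi Set.univ fun r' => if r' = r then F j else Set.univ := by
    rintro ω (h | ⟨r, j, hj, h⟩)
    · exact Or.inl fun r _ => h r
    · refine Or.inr (Set.mem_biUnion (Finset.mem_univ r) (Set.mem_biUnion hj fun r' _ => ?_))
      by_cases hr : r' = r
      · subst hr
        simpa using h
      · simp [hr]
  refine (measure_mono hsub).trans ((measure_union_le _ _).trans ?_)
  rw [ENNReal.ofReal_add (Real.exp_pos _).le (by positivity)]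
  refine add_le_add ?_ ?_
  · rw [Measure.pi_pi, Finset.prod_const, Finset.card_univ, Fintype.card_fin,
      prob_compl_eq_one_sub hA]
    have h1 : 1 - μ A ≤ ENNReal.ofReal (1 - a) := by
      rw [ENNReal.ofReal_sub _ ha, ENNReal.ofReal_one]
      exact tsub_le_tsub_left hμA _
    refine (pow_le_pow_left' h1 R).trans ?_
    rw [← ENNReal.ofReal_pow (by linarith)]
    refine ENNReal.ofReal_le_ofReal ?_
    have h2 : 1 - a ≤ Real.exp (-a) := by linarith [Real.add_one_le_exp (-a)]
    calc (1 - a) ^ R ≤ Real.exp (-a) ^ R := pow_le_pow_left₀ (by linarith) h2 R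
      _ = Real.exp (-(a * R)) := by rw [← Real.exp_nat_mul]; ring_nf
  · refine (measure_biUnion_finset_le _ _).trans ?_
    have hj : ∀ r : Fin R, ∀ j ∈ J, Measure.pi (fun _ : Fin R => μ)
        (Set.pi Set.univ fun r' => if r' = r then F j else Set.univ) ≤ ENNReal.ofReal b := by
      intro r j hj
      rw [Measure.pi_pi, Finset.prod_eq_single r (fun r' _ hr => by simp [hr]) (by simp)]
      simpa using hμF j hj
    have hr : ∀ r ∈ (Finset.univ : Finset (Fin R)), Measure.pi (fun _ : Fin R => μ)
        (⋃ j ∈ J, Set.pi Set.univ fun r' => if r' = r then F j else Set.univ) ≤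
        n * ENNReal.ofReal b := by
      intro r _
      refine (measure_biUnion_finset_le _ _).trans ((Finset.sum_le_sum (hj r)).trans ?_)
      rw [Finset.sum_const, nsmul_eq_mul]
      gcongr
      simpa using Finset.card_le_univ J
    refine (Finset.sum_le_sum hr).trans (le_of_eq ?_)
    rw [Finset.sum_const, Finset.card_univ, Fintype.card_fin, nsmul_eq_mul, mul_assoc,
      ENNReal.ofReal_mul (by positivity), ENNReal.ofReal_mul (by positivity),
      ENNReal.ofReal_natCast, ENNReal.ofReal_natCast]

/-! ### The data structure -/

open MeasureTheory RealRAM in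
/-- The correctness of the data structure, for all admissible values of its parameters: `κ` is the
exponent, `J` bounds the box size of the trees, `R` is the number of trees, each with at most `m`
nodes. The factor `10000` keeps the union bound over all far points and all trees below `6 / 10000`,
also when `n` is small. -/
theorem solvesANN_annProg {d n : ℕ} (hd : 2 ≤ d) (hn : 1 ≤ n) {N : Seminorm ℝ (Fin d → ℝ)}
    (hN : IsSymmetricNorm N) (P : Fin n → Fin d → ℝ) {ρ c κ : ℝ} (hρ : 0 < ρ) (hκ : 0 < κ)
    {J R m w S T : ℕ} (hJ : (1 / 2 : ℝ) ^ ((1 + κ) ^ J) < 1 / (4 * d))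
    (hR : 5 * (10000 * n : ℝ) ^ κ ≤ R) (hR' : (R : ℝ) ≤ 6 * (10000 * n : ℝ) ^ κ)
    (hm : 2 * (n : ℝ) ^ (1 + κ) - 1 ≤ m) (hS : S = 5 * (R * m + 2) + (n + R) * d)
    (hw : S < 2 ^ w) (hT : R * ⌊64 * d * (1 + Real.log n)⌋₊ + 5 ≤ T)
    (hc : (1 + κ) / κ * (7 * Real.logb (3 / 2) d) * (2 * (4 * J + 3)) ≤ c) :
    SolvesANN annProg N P ρ c w S T := by
  set α := (1 + κ) / κ with hα
  set L := Real.logb (3 / 2) d with hL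
  set D : ℝ := 4 * J + 3 with hD
  have hD0 : 0 < D := by positivity
  have hα1 : 1 < α := by rw [hα, one_lt_div hκ]; linarith
  have hL0 : 0 < L := Real.logb_pos (by norm_num) (by exact_mod_cast hd)
  have hn1 : (1 : ℝ) ≤ n := by exact_mod_cast hn
  have hX : (1 : ℝ) < 10000 * n := by linarith
  have hlogX : 0 < Real.log (10000 * n) := Real.log_pos hX
  obtain ⟨G, hG, hGtop, hG0, hGN⟩ := hN.exists_orlicz (β := 3 / 2) (by norm_num) (by norm_num)
    (by omega) hα1
  -- this rate balances the probability that a near point survives against the number of trees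
  set lam := κ * Real.log (10000 * n) / (2 * L) with hlam
  have hlam0 : 0 < lam := by positivity
  obtain ⟨μ, t, hμ, ht, hnear, hfar⟩ := exists_random_widths hG hGtop hG0 hlam0 d
  have ht' : ∀ ω i, 0 < ρ * t ω i := fun ω i => mul_pos hρ (ht ω i)
  choose tree _ htree hsearch using fun ω => exists_searchTree P (ht' ω) hκ (by omega) hJ Finset.univ
  have huniv : (Finset.univ : Finset (Fin n)).Nonempty := ⟨⟨0, hn⟩, Finset.mem_univ _⟩
  simp only [huniv, forall_true_left, Finset.card_univ, Fintype.card_fin] at htree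
  have hsize : ∀ ω, (tree ω).size ≤ m := fun ω => by
    have := (htree ω).1.trans hm
    exact_mod_cast this
  have hcost : ∀ ω, (tree ω).cost ≤ ⌊64 * d * (1 + Real.log n)⌋₊ := fun ω =>
    Nat.le_floor (htree ω).2
  have hmem : ∀ ω : Fin R → Fin d → ℝ, ∃ M : Memory w S, ∀ q : Fin d → ℝ,
      (run annProg M q T).pc = 37 ∧
      ((∃ r j, (tree (ω r)).search P (fun i => D * (ρ * t (ω r) i)) q = some j ∧
          (run annProg M q T).output = j) ∨
        ∀ r, (tree (ω r)).search P (fun i => D * (ρ * t (ω r) i)) q = none) := by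
    intro ω
    have h1 : ∑ r, (tree (ω r)).size ≤ R * m := by
      refine (Finset.sum_le_sum fun r _ => hsize (ω r)).trans ?_
      simp
    have h2 : ∑ r, (tree (ω r)).cost ≤ R * ⌊64 * d * (1 + Real.log n)⌋₊ := by
      refine (Finset.sum_le_sum fun r _ => hcost (ω r)).trans ?_
      simp
    obtain ⟨M, hM⟩ := exists_memory P (fun r => tree (ω r))
      (fun r i => D * (ρ * t (ω r) i)) (by omega) (by omega) (M := R * m + 2) (by omega) hS hw
    refine ⟨M, fun q => ?_⟩
    obtain ⟨k, hk, hpc, hout⟩ := hM q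
    rw [run_eq_of_halted (by omega : k ≤ T) hpc]
    exact ⟨hpc, hout⟩
  choose mem hpc hout using hmem
  refine ⟨Fin R → Fin d → ℝ, inferInstance, Measure.pi fun _ => μ, mem, inferInstance,
    fun ω q => ⟨(hpc ω q).ge, run_mem _ _ _⟩, ?_⟩
  rintro q ⟨i₀, hi₀⟩
  set x : Fin n → Fin d → ℝ := fun j => ρ⁻¹ • (P j - q) with hx
  have hNx : ∀ j, N (x j) = N (P j - q) / ρ := fun j => by
    rw [hx, map_smul_eq_mul, norm_inv, Real.norm_of_nonneg hρ.le, inv_mul_eq_div]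
  have habs : ∀ j i (s : ℝ), |x j i| ≤ s ↔ |P j i - q i| ≤ ρ * s := fun j i s => by
    simp only [hx, Pi.smul_apply, Pi.sub_apply, smul_eq_mul, abs_mul, abs_inv, abs_of_pos hρ]
    rw [inv_mul_le_iff₀ hρ]
  obtain ⟨A, hA, hAx, hAμ⟩ := hnear (x i₀)
  set a : ℝ := (10000 * n : ℝ) ^ (-κ) with ha
  set b : ℝ := (10000 * n : ℝ) ^ (-(1 + κ)) with hb
  have hμA : ENNReal.ofReal a ≤ μ A := by
    refine le_trans (ENNReal.ofReal_le_ofReal ?_) hAμ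
    have h1 := (hGN (x i₀)).1 (by rw [hNx]; exact div_le_one_of_le₀ hi₀ hρ.le)
    rw [ha, Real.rpow_def_of_pos (by linarith), Real.exp_le_exp]
    have h2 : lam * ∑ i, (G ‖x i₀ i‖₊ : ℝ) ≤ lam * (2 * L) := mul_le_mul_of_nonneg_left h1 hlam0.le
    have h3 : lam * (2 * L) = κ * Real.log (10000 * n) := by rw [hlam]; field_simp
    linarith
  set far : Finset (Fin n) := Finset.univ.filter fun j => ¬ N (P j - q) ≤ c * ρ with hfardef
  have hμF : ∀ j ∈ far, μ {ω | ∀ i, |x j i| ≤ D * t ω i} ≤ ENNReal.ofReal b := by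
    intro j hj
    refine (hfar (x j) D hD0).trans (ENNReal.ofReal_le_ofReal ?_)
    have hj' : c * ρ < N (P j - q) := not_le.1 (Finset.mem_filter.1 hj).2
    have h0 : N (fun i => x j i / (2 * D)) = N (x j) / (2 * D) := by
      have : (fun i => x j i / (2 * D)) = (2 * D)⁻¹ • x j := by
        funext i
        simp [div_eq_inv_mul]
      rw [this, map_smul_eq_mul, norm_inv, Real.norm_of_nonneg (by positivity), inv_mul_eq_div]
    have h1 := (hGN fun i => x j i / (2 * D)).2 (by
      rw [h0, hNx, lt_div_iff₀ (by positivity), lt_div_iff₀ hρ]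
      exact lt_of_le_of_lt (mul_le_mul_of_nonneg_right hc hρ.le) hj')
    rw [hb, Real.rpow_def_of_pos (by linarith), Real.exp_le_exp]
    have h2 := mul_le_mul_of_nonneg_left h1 hlam0.le
    have h3 : lam * (α * (2 * L)) = (1 + κ) * Real.log (10000 * n) := by
      rw [hlam, hα]
      field_simp
    linarith
  have ha0 : 0 < a := Real.rpow_pos_of_pos (by linarith) _
  have hb0 : 0 < b := Real.rpow_pos_of_pos (by linarith) _
  have ha1 : a ≤ 1 := Real.rpow_le_one_of_one_le_of_nonpos hX.le (by linarith)
  have hmain := measure_pi_fail_le (R := R) hA ha0.le ha1 hb0.le hμA hμF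
  refine (measure_mono fun ω hω => ?_).trans (hmain.trans ?_)
  · by_contra hgood
    simp only [Set.mem_ofPred_eq, not_or, not_forall, not_not, not_exists, not_and] at hgood
    obtain ⟨⟨r, hr⟩, hnofar⟩ := hgood
    refine hω ?_
    have hfound : ∃ j, (tree (ω r)).search P (fun i => D * (ρ * t (ω r) i)) q = some j :=
      hsearch (ω r) q ⟨i₀, Finset.mem_univ _, fun i => (habs _ _ _).1 (hAx _ hr i)⟩
    rcases hout ω q with ⟨r', j, hj, hjout⟩ | hnone
    · refine ⟨j, hjout, ?_⟩
      by_contra hjfar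
      refine absurd (fun i => (habs _ _ _).2 ?_)
        (not_forall.2 (hnofar r' j (Finset.mem_filter.2 ⟨Finset.mem_univ _, hjfar⟩)))
      have := SearchTree.search_sound hj i
      linarith
    · obtain ⟨j, hj⟩ := hfound
      rw [hnone r] at hj
      exact absurd hj (by simp)
  · rw [show (1 / 100 : ENNReal) = ENNReal.ofReal (1 / 100) by
      rw [ENNReal.ofReal_div_of_pos (by norm_num)]; simp]
    refine ENNReal.ofReal_le_ofReal ?_
    have h1 : (10000 * n : ℝ) ^ κ * a = 1 := by
      rw [ha, ← Real.rpow_add (by linarith)]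
      simp
    have h2 : (10000 * n : ℝ) ^ κ * b = (10000 * n : ℝ)⁻¹ := by
      rw [hb, ← Real.rpow_add (by linarith), ← Real.rpow_neg_one]
      congr 1
      ring
    have h3 : 5 ≤ a * R := by
      have := mul_le_mul_of_nonneg_left hR ha0.le
      linarith
    have h4 : (R : ℝ) * n * b ≤ 6 / 10000 := by
      calc (R : ℝ) * n * b ≤ 6 * (10000 * n : ℝ) ^ κ * n * b := by gcongr
        _ = 6 * n * ((10000 * n : ℝ) ^ κ * b) := by ring
        _ = 6 / 10000 := by
          rw [h2]
          field_simp
    have h5 : Real.exp (-(a * R)) ≤ 7 / 1000 := by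
      refine (Real.exp_le_exp.2 (show -(a * R) ≤ -5 by linarith)).trans ?_
      rw [Real.exp_neg, show (5 : ℝ) = (5 : ℕ) * 1 by norm_num, Real.exp_nat_mul]
      have h6 : (2.7 : ℝ) ^ 5 ≤ Real.exp 1 ^ 5 :=
        pow_le_pow_left₀ (by norm_num) (by linarith [Real.exp_one_gt_d9]) 5
      calc (Real.exp 1 ^ 5)⁻¹ ≤ ((2.7 : ℝ) ^ 5)⁻¹ := inv_anti₀ (by norm_num) h6
        _ ≤ 7 / 1000 := by norm_num
    linarith

/-- The depth `J` of the tails needed in dimension `d` is `O(log log d / κ)`. -/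
lemma exists_tail_depth {κ : ℝ} (hκ : 0 < κ) (hκ1 : κ ≤ 1) {d : ℕ} (hd : 3 ≤ d) :
    ∃ J : ℕ, (1 / 2 : ℝ) ^ ((1 + κ) ^ J) < 1 / (4 * d) ∧
      (J : ℝ) ≤ 2 / κ * (2 + Real.log (Real.log d)) + 1 := by
  have hd3 : (3 : ℝ) ≤ d := by exact_mod_cast hd
  have hlogd : 1 < Real.log d := by
    rw [Real.lt_log_iff_exp_lt (by linarith)]
    linarith [Real.exp_one_lt_d9]
  have hlog2 := Real.log_two_gt_d9
  have hlog2' := Real.log_two_lt_d9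
  have hlog4 : Real.log (4 * d) ≤ 3 * Real.log d := by
    rw [Real.log_mul (by norm_num) (by linarith), show (4 : ℝ) = 2 ^ 2 by norm_num, Real.log_pow]
    push_cast
    linarith
  have hlog4' : 0 < Real.log (4 * d) := Real.log_pos (by linarith)
  refine ⟨⌈2 / κ * Real.log (2 * Real.log (4 * d))⌉₊, ?_, ?_⟩
  · set J := ⌈2 / κ * Real.log (2 * Real.log (4 * d))⌉₊ with hJ
    have h1 : 2 / κ * Real.log (2 * Real.log (4 * d)) ≤ J := Nat.le_ceil _
    have h2 : κ / 2 ≤ Real.log (1 + κ) := by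
      refine le_trans ?_ (Real.one_sub_inv_le_log_of_pos (by linarith))
      rw [show 1 - (1 + κ)⁻¹ = κ / (1 + κ) by field_simp; ring]
      gcongr
      linarith
    have h3 : Real.log (2 * Real.log (4 * d)) ≤ J * Real.log (1 + κ) := by
      have h4 : Real.log (2 * Real.log (4 * d)) ≤ J * (κ / 2) := by
        rw [div_mul_eq_mul_div, div_le_iff₀ hκ] at h1
        linarith
      exact h4.trans (mul_le_mul_of_nonneg_left h2 (Nat.cast_nonneg J))
    rw [← Real.log_pow, Real.log_le_log_iff (by linarith) (by positivity)] at h3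
    rw [Real.rpow_def_of_pos (by norm_num), one_div (4 * d : ℝ),
      ← Real.exp_log (show (0 : ℝ) < (4 * d : ℝ)⁻¹ by positivity), Real.exp_lt_exp, Real.log_inv,
      one_div, Real.log_inv]
    nlinarith
  · refine (Nat.ceil_lt_add_one ?_).le.trans ?_
    · refine mul_nonneg (by positivity) (Real.log_nonneg ?_)
      have : Real.log 4 ≤ Real.log (4 * d) := Real.log_le_log (by norm_num) (by linarith)
      have h4 : Real.log 4 = 2 * Real.log 2 := by
        rw [show (4 : ℝ) = 2 ^ 2 by norm_num, Real.log_pow]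
        push_cast
        ring
      linarith
    · gcongr
      calc Real.log (2 * Real.log (4 * d)) ≤ Real.log (6 * Real.log d) :=
            Real.log_le_log (by linarith) (by linarith)
        _ = Real.log 6 + Real.log (Real.log d) := Real.log_mul (by norm_num) (by linarith)
        _ ≤ 2 + Real.log (Real.log d) := by
          gcongr
          rw [Real.log_le_iff_le_exp (by norm_num), show (2 : ℝ) = (2 : ℕ) * 1 by norm_num,
            Real.exp_nat_mul]
          nlinarith [Real.exp_one_gt_d9]

/-- The approximation factor required by `solvesANN_annProg` is `O(log d * log log d / κ ^ 2)`. -/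
lemma exists_approximation_const :
    ∃ C : ℝ, 0 < C ∧ ∀ (κ : ℝ) (d : ℕ), 0 < κ → κ ≤ 1 → 3 ≤ d →
      ∃ J : ℕ, (1 / 2 : ℝ) ^ ((1 + κ) ^ J) < 1 / (4 * d) ∧
        (1 + κ) / κ * (7 * Real.logb (3 / 2) d) * (2 * (4 * J + 3)) ≤
          C * (Real.log d * Real.log (Real.log d) / κ ^ 2) := by
  have hl3 : 0 < Real.log (Real.log 3) := by
    refine Real.log_pos ?_
    rw [Real.lt_log_iff_exp_lt (by norm_num)]
    linarith [Real.exp_one_lt_d9]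
  have hl : 0 < Real.log (3 / 2) := Real.log_pos (by norm_num)
  set B : ℝ := 8 * (2 / Real.log (Real.log 3) + 1) + 7 / Real.log (Real.log 3) with hB
  have hB0 : 0 < B := by positivity
  refine ⟨28 * B / Real.log (3 / 2), by positivity, fun κ d hκ hκ1 hd => ?_⟩
  obtain ⟨J, hJ, hJle⟩ := exists_tail_depth hκ hκ1 hd
  refine ⟨J, hJ, ?_⟩
  have hd3 : (3 : ℝ) ≤ d := by exact_mod_cast hd
  have hlog3 : 0 < Real.log 3 := Real.log_pos (by norm_num)
  have hlogd : Real.log 3 ≤ Real.log d := Real.log_le_log (by norm_num) hd3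
  set ℓ := Real.log (Real.log d) with hℓ
  have hℓ3 : Real.log (Real.log 3) ≤ ℓ := Real.log_le_log hlog3 hlogd
  have hone : 1 ≤ ℓ / Real.log (Real.log 3) := (one_le_div hl3).2 hℓ3
  have hD : 4 * (J : ℝ) + 3 ≤ B * ℓ / κ := by
    have h1 : 2 + ℓ ≤ (2 / Real.log (Real.log 3) + 1) * ℓ := by
      have : (2 / Real.log (Real.log 3) + 1) * ℓ = 2 * (ℓ / Real.log (Real.log 3)) + ℓ := by ring
      linarith
    have h2 : (7 : ℝ) ≤ 7 / Real.log (Real.log 3) * ℓ / κ := by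
      rw [le_div_iff₀ hκ]
      have : 7 / Real.log (Real.log 3) * ℓ = 7 * (ℓ / Real.log (Real.log 3)) := by ring
      linarith
    have h3 : 2 / κ * (2 + ℓ) ≤ 2 / κ * ((2 / Real.log (Real.log 3) + 1) * ℓ) :=
      mul_le_mul_of_nonneg_left h1 (by positivity)
    have h4 : B * ℓ / κ = 4 * (2 / κ * ((2 / Real.log (Real.log 3) + 1) * ℓ)) +
        7 / Real.log (Real.log 3) * ℓ / κ := by
      rw [hB]
      ring
    linarith
  have hα : (1 + κ) / κ ≤ 2 / κ := by gcongr; linarith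
  have hlogb : 0 ≤ Real.logb (3 / 2) d := Real.logb_nonneg (by norm_num) (by linarith)
  calc (1 + κ) / κ * (7 * Real.logb (3 / 2) d) * (2 * (4 * J + 3))
      ≤ 2 / κ * (7 * Real.logb (3 / 2) d) * (2 * (B * ℓ / κ)) := by gcongr
    _ = 28 * B / Real.log (3 / 2) * (Real.log d * ℓ / κ ^ 2) := by
      rw [Real.logb]
      ring

/-- The number of trees and their sizes, for exponent `κ = ε / 2`. -/
lemma exists_space_params {κ : ℝ} (hκ : 0 < κ) (hκ4 : κ ≤ 1 / 4) {d n : ℕ} (hd : 3 ≤ d)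
    (hn : 1 ≤ n) :
    ∃ R m w S : ℕ, 5 * (10000 * n : ℝ) ^ κ ≤ R ∧ (R : ℝ) ≤ 6 * (10000 * n : ℝ) ^ κ ∧
      2 * (n : ℝ) ^ (1 + κ) - 1 ≤ m ∧ S = 5 * (R * m + 2) + (n + R) * d ∧ S < 2 ^ w ∧
      (R : ℝ) ≤ 60 * (n : ℝ) ^ κ ∧ (S : ℝ) ≤ 700 * (d * (n : ℝ) ^ (1 + 2 * κ)) ∧
      (w : ℝ) ≤ 25 * Real.log (n * d) := by
  have hn1 : (1 : ℝ) ≤ n := by exact_mod_cast hn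
  have hd3 : (3 : ℝ) ≤ d := by exact_mod_cast hd
  have hX1 : 1 ≤ (10000 * n : ℝ) ^ κ := Real.one_le_rpow (by linarith) hκ.le
  set R := ⌈5 * (10000 * n : ℝ) ^ κ⌉₊ with hRdef
  set m := ⌊2 * (n : ℝ) ^ (1 + κ)⌋₊ with hmdef
  have hR : (R : ℝ) ≤ 6 * (10000 * n : ℝ) ^ κ := by
    have := (Nat.ceil_lt_add_one (show 0 ≤ 5 * (10000 * n : ℝ) ^ κ by positivity)).le
    linarith
  have hXn : (10000 * n : ℝ) ^ κ ≤ 10 * (n : ℝ) ^ κ := by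
    rw [Real.mul_rpow (by norm_num) (by linarith)]
    gcongr
    calc (10000 : ℝ) ^ κ ≤ 10000 ^ (1 / 4 : ℝ) :=
          Real.rpow_le_rpow_of_exponent_le (by norm_num) hκ4
      _ = 10 := by
        rw [show (10000 : ℝ) = 10 ^ (4 : ℝ) by norm_num, ← Real.rpow_mul (by norm_num)]
        norm_num
  have hR60 : (R : ℝ) ≤ 60 * (n : ℝ) ^ κ := by linarith
  have hm : (m : ℝ) ≤ 2 * (n : ℝ) ^ (1 + κ) := Nat.floor_le (by positivity)
  set Y := (n : ℝ) ^ (1 + 2 * κ) with hY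
  have hnκ : (n : ℝ) ^ κ * (n : ℝ) ^ (1 + κ) = Y := by
    rw [← Real.rpow_add (by linarith), hY]
    congr 1
    ring
  have hY1 : 1 ≤ Y := Real.one_le_rpow hn1 (by linarith)
  have hnY : (n : ℝ) ≤ Y := Real.self_le_rpow_of_one_le hn1 (by linarith)
  have hκY : (n : ℝ) ^ κ ≤ Y := Real.rpow_le_rpow_of_exponent_le hn1 (by linarith)
  set S := 5 * (R * m + 2) + (n + R) * d with hSdef
  have hS : (S : ℝ) ≤ 700 * (d * Y) := by
    rw [hSdef]
    push_cast
    have h1 : (R : ℝ) * m ≤ 60 * (n : ℝ) ^ κ * (2 * (n : ℝ) ^ (1 + κ)) := by gcongr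
    have h2 : 60 * (n : ℝ) ^ κ * (2 * (n : ℝ) ^ (1 + κ)) = 120 * Y := by rw [← hnκ]; ring
    have h3 : ((n : ℝ) + R) * d ≤ (61 * Y) * d := by
      gcongr
      linarith
    have h4 : Y * 3 ≤ Y * d := by gcongr
    nlinarith
  have hS10 : 10 ≤ S := by omega
  refine ⟨R, m, Nat.log 2 S + 1, S, Nat.le_ceil _, hR, ?_, rfl,
    Nat.lt_pow_succ_log_self (by norm_num) S, hR60, hS, ?_⟩
  · have := (Nat.lt_floor_add_one (2 * (n : ℝ) ^ (1 + κ))).le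
    linarith
  · have hlog3 : 1 ≤ Real.log (n * d) := by
      rw [Real.le_log_iff_exp_le (by positivity)]
      have : 1 * 3 ≤ (n : ℝ) * d := by gcongr
      linarith [Real.exp_one_lt_d9]
    have hlog2 := Real.log_two_gt_d9
    have hlog2' := Real.log_two_lt_d9
    have hYn : Y ≤ (n : ℝ) ^ 2 := by
      rw [← Real.rpow_natCast]
      exact Real.rpow_le_rpow_of_exponent_le hn1 (by push_cast; linarith)
    have hS2 : (S : ℝ) ≤ 2 ^ 10 * (n * d : ℝ) ^ 2 := by
      have h1 : (d : ℝ) * Y ≤ d ^ 2 * n ^ 2 := by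
        gcongr
        nlinarith
      have h2 : (0 : ℝ) ≤ d ^ 2 * n ^ 2 := by positivity
      have h3 : (n * d : ℝ) ^ 2 = d ^ 2 * n ^ 2 := by ring
      rw [h3]
      linarith
    have hSlog : Real.log S ≤ 12 * Real.log (n * d) := by
      refine (Real.log_le_log (by positivity) hS2).trans ?_
      rw [Real.log_mul (by norm_num) (by positivity), Real.log_pow, Real.log_pow]
      push_cast
      linarith
    have h1 : (Nat.log 2 S : ℝ) ≤ Real.logb 2 S := by exact_mod_cast Real.natLog_le_logb S 2
    have h2 : Real.logb 2 S ≤ 24 * Real.log (n * d) := by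
      rw [Real.logb, div_le_iff₀ (by linarith)]
      nlinarith
    push_cast
    linarith

/-- The query time for exponent `κ = ε / 2`. -/
lemma time_le {κ : ℝ} (hκ : 0 < κ) {d n R : ℕ} (hd : 1 ≤ d) (hn : 1 ≤ n)
    (hR : (R : ℝ) ≤ 60 * (n : ℝ) ^ κ) :
    ((R * ⌊64 * d * (1 + Real.log n)⌋₊ + 5 : ℕ) : ℝ) ≤
      (3840 * (1 + 1 / κ) + 5) * (d * (n : ℝ) ^ (2 * κ)) := by
  have hn1 : (1 : ℝ) ≤ n := by exact_mod_cast hn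
  have hd1 : (1 : ℝ) ≤ d := by exact_mod_cast hd
  have hlog : 0 ≤ Real.log n := Real.log_nonneg hn1
  have hZ : 1 ≤ (n : ℝ) ^ κ := Real.one_le_rpow hn1 hκ.le
  have h1 : 1 + Real.log n ≤ (1 + 1 / κ) * (n : ℝ) ^ κ := by
    have := Real.log_le_rpow_div (Nat.cast_nonneg n) hκ
    have e : (1 + 1 / κ) * (n : ℝ) ^ κ = (n : ℝ) ^ κ + (n : ℝ) ^ κ / κ := by ring
    linarith
  have h2 : (⌊64 * d * (1 + Real.log n)⌋₊ : ℝ) ≤ 64 * d * ((1 + 1 / κ) * (n : ℝ) ^ κ) :=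
    (Nat.floor_le (by positivity)).trans (by gcongr)
  have h3 : (n : ℝ) ^ (2 * κ) = (n : ℝ) ^ κ * (n : ℝ) ^ κ := by
    rw [two_mul, Real.rpow_add (by linarith)]
  have h4 : 1 ≤ (d : ℝ) * (n : ℝ) ^ (2 * κ) := by
    rw [h3]
    exact one_le_mul_of_one_le_of_one_le hd1 (one_le_mul_of_one_le_of_one_le hZ hZ)
  push_cast
  calc (R : ℝ) * ⌊64 * d * (1 + Real.log n)⌋₊ + 5
      ≤ 60 * (n : ℝ) ^ κ * (64 * d * ((1 + 1 / κ) * (n : ℝ) ^ κ)) + 5 := by gcongr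
    _ = 3840 * (1 + 1 / κ) * (d * (n : ℝ) ^ (2 * κ)) + 5 := by rw [h3]; ring
    _ ≤ (3840 * (1 + 1 / κ) + 5) * (d * (n : ℝ) ^ (2 * κ)) := by linarith

theorem mainTheorem7 :
    -- every symmetric norm is approximated, up to `O(log d)`, by an Orlicz-type function `G`
    (∀ β : ℝ, 1 < β → β < 2 →
      ∀ d : ℕ, 1 ≤ d → ∀ N : Seminorm ℝ (Fin d → ℝ), IsSymmetricNorm N →
      ∀ D α : ℝ, 1 < D → 1 < α →
      ∃ G : ℝ≥0 → ℝ≥0, Monotone G ∧ G 0 = 0 ∧ Filter.Tendsto G Filter.atTop Filter.atTop ∧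
        ∀ x : Fin d → ℝ,
          (N x ≤ 1 → (∑ i, (G ‖x i‖₊ : ℝ)) ≤ 2 * Real.logb β d) ∧
          (α * D * (7 * Real.logb β d) < N x →
            α * (2 * Real.logb β d) ≤ ∑ i, (G ‖x i / D‖₊ : ℝ))) ∧
    -- the data structure: one query program, an absolute constant `C` for approximation, space and
    -- word length, and a constant `K` depending only on `ε` for the query time
    (∃ (prog : RealRAM.Program) (C : ℝ), 0 < C ∧
      ∀ ε : ℝ, 0 < ε → ε < 1 / 2 →
      ∃ K : ℝ, 0 < K ∧
        ∀ d n : ℕ, 3 ≤ d → 1 ≤ n →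
        ∀ N : Seminorm ℝ (Fin d → ℝ), IsSymmetricNorm N →
        ∀ (P : Fin n → Fin d → ℝ) (r : ℝ), 0 < r →
        ∃ w S T : ℕ,
          (w : ℝ) ≤ C * Real.log (n * d) ∧
          ((2 * S : ℕ) : ℝ) ≤ C * (d * (n : ℝ) ^ (1 + ε)) ∧
          (T : ℝ) ≤ K * (d * (n : ℝ) ^ ε) ∧
          SolvesANN prog N P r (C * (Real.log d * Real.log (Real.log d) / ε ^ 2)) w S T) := by

  refine ⟨fun β hβ1 hβ2 d hd N hN D α hD hα => ?_, ?_⟩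
  · obtain ⟨G, hG, hGtop, ⟨δ, -, hGδ⟩, hGN⟩ := hN.exists_orlicz hβ1 hβ2 hd hα
    refine ⟨G, hG, le_antisymm ((hG zero_le).trans hGδ.le) zero_le, hGtop,
      fun x => ⟨(hGN x).1, fun hx => (hGN fun i => x i / D).2 ?_⟩⟩
    have hD0 : 0 < D := by linarith
    have : (fun i => x i / D) = D⁻¹ • x := by
      funext i
      simp [div_eq_inv_mul]
    rw [this, map_smul_eq_mul, norm_inv, Real.norm_of_nonneg hD0.le, inv_mul_eq_div,
      lt_div_iff₀ hD0]
    linarith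
  · obtain ⟨C, hC, hCJ⟩ := exists_approximation_const
    refine ⟨RealRAM.annProg, 1400 + 4 * C, by positivity, fun ε hε hε2 => ?_⟩
    have hκ : 0 < ε / 2 := by linarith
    refine ⟨3840 * (1 + 1 / (ε / 2)) + 5, by positivity, fun d n hd hn N hN P r hr => ?_⟩
    obtain ⟨J, hJ, hJc⟩ := hCJ (ε / 2) d hκ (by linarith) hd
    obtain ⟨R, m, w, S, hR, hR', hm, hS, hw, hR60, hSle, hwle⟩ :=
      exists_space_params hκ (by linarith) hd hn
    have hd3 : (3 : ℝ) ≤ d := by exact_mod_cast hd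
    have hn1 : (1 : ℝ) ≤ n := by exact_mod_cast hn
    have hε' : 2 * (ε / 2) = ε := by ring
    rw [hε'] at hSle
    have htime := time_le hκ (by omega : 1 ≤ d) hn hR60
    rw [hε'] at htime
    refine ⟨w, S, R * ⌊64 * d * (1 + Real.log n)⌋₊ + 5, ?_, ?_, htime,
      solvesANN_annProg (by omega) hn hN P hr hκ hJ hR hR' hm hS hw le_rfl (hJc.trans ?_)⟩
    · refine hwle.trans (mul_le_mul_of_nonneg_right (by linarith) (Real.log_nonneg ?_))
      nlinarith
    · have : 0 ≤ C * (d * (n : ℝ) ^ (1 + ε)) := by positivity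
      push_cast
      linarith
    · have hlog : 0 ≤ Real.log d * Real.log (Real.log d) / ε ^ 2 := by
        have h1 : 1 ≤ Real.log d := by
          rw [Real.le_log_iff_exp_le (by linarith)]
          linarith [Real.exp_one_lt_d9]
        have := Real.log_nonneg h1
        positivity
      have e : Real.log d * Real.log (Real.log d) / (ε / 2) ^ 2 =
          4 * (Real.log d * Real.log (Real.log d) / ε ^ 2) := by
        field_simp
        ring
      rw [e]
      linarith
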